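/- All graphs are finite and simple. For a positive integer $k$, two proper $k$-colorings $f,f'$ of a graph $G$ are adjacent under color swapping if there is an edge $uv$ of $G$ with $f'(u)=f(v)$, $f'(v)=f(u)$ and $f'(w)=f(w)$ for all other vertices $w$; they are reconfigurable if there is a finite sequence of proper $k$-colorings of $G$ from $f$ to $f'$ in which consecutive colorings are adjacent. An instance $(G,f_s,f_t,k)$ of CRCS consists of a graph $G$, an integer $k\ge 1$ and two proper $k$-colorings $f_s,f_t$ of $G$; it is a yes-instance if $f_s$ and $f_t$ are reconfigurable, and it is valid if $|f_s^{-1}(c)|=|f_t^{-1}(c)|$ for every color $c$. A graph is split if its vertex set can be partitioned into a clique $C$ and an independent set $I$ (either may be empty). Let $(G,f_s,f_t,k)$ be an instance of CRCS in which $G$ is a split graph with such a partition $(C,I)$. Consider two reduction rules. Rule 1 applies to distinct $u,v\in I$ if $N(u)=N(v)$, $f_s(u)=f_s(v)$, and $f_s(u)\ne f_t(u)$ or $f_s(v)\ne f_t(v)$; it answers NO. Rule 2 applies to distinct $u,v,w\in I$ if $N(u)=N(v)=N(w)$ and $f_s(u)=f_s(v)=f_s(w)$; it deletes $w$ from $G$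 and restricts $f_s$ and $f_t$ to the remaining vertices. Theorem. (1) If Rule 1 applies, then the instance is a no-instance. (2) If Rule 1 does not apply to any pair of vertices and Rule 2 applies to $u,v,w$, then the instance produced by Rule 2 is an instance on a split graph with partition $(C,I\setminus\{w\})$, it is valid if the given instance is valid, and it is a yes-instance if and only if the given instance is a yes-instance. (3) CRCS on split graphs, parameterized by the number $k$ of colors, admits a kernel with at most $k+2k\cdot 2^k$ vertices. That is, there is a map computable by a Turing machine in time polynomial in the length of the encoding of the instance (adjacency matrix, and numbers in binary) that transforms every instance $(G,f_s,f_t,k)$ with $G$ split into an equivalent instance $(G',f_s',f_t',k')$ with $G'$ split and $|V(G')|\le k+2k\cdot 2^k$, such that the length of the encoding of the new instance plus $k'$ is at most $h(k)$ for some computable function $h$ independent of the instance. Moreover, this map sends valid instances to valid instances. -/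

import Mathlib

open Computability

universe u

/-- `f` and `f'` are adjacent under color swapping: for some edge `ab` the coloring `f'` arises from
`f` by exchanging the colors of `a` and `b`. (Both colorings being proper, the edge is unique.) -/
def ColorSwapAdj {V : Type u} {G : SimpleGraph V} {k : ℕ} (f f' : G.Coloring (Fin k)) : Prop :=
  ∃ a b : V, G.Adj a b ∧ f a = f' b ∧ f b = f' a ∧ ∀ w : V, w ≠ a → w ≠ b → f w = f' w

/-- There is a finite sequence of proper colorings from `f` to `f'`, consecutive ones being adjacent
under color swapping. -/
def Reconfigurable {V : Type u} {G : SimpleGraph V} {k : ℕ} (f f' : G.Coloring (Fin k)) : Prop :=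
  Relation.ReflTransGen ColorSwapAdj f f'

/-- `C` and `I` partition the vertex set, `C` is a clique and `I` is an independent set
(either part may be empty). -/
structure IsSplitPartition {V : Type u} (G : SimpleGraph V) (C I : Set V) : Prop where
  clique : G.IsClique C
  indep : G.IsIndepSet I
  disjoint : Disjoint C I
  union_eq : C ∪ I = Set.univ

def IsSplitGraph {V : Type u} (G : SimpleGraph V) : Prop :=
  ∃ C I : Set V, IsSplitPartition G C I

/-- An instance `(G, k, f_s, f_t)` of Coloring Reconfiguration under Color Swapping, where `G` has
vertex set `V`. The `k` colors are the elements of `Fin k`. -/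
structure CRCSInstance (V : Type u) where
  graph : SimpleGraph V
  numColors : ℕ
  numColors_pos : 0 < numColors
  source : graph.Coloring (Fin numColors)
  target : graph.Coloring (Fin numColors)

namespace CRCSInstance

variable {V : Type u}

def IsYes (x : CRCSInstance V) : Prop := Reconfigurable x.source x.target

/-- Every color is used equally often in the two colorings. -/
def IsValid (x : CRCSInstance V) : Prop :=
  ∀ c : Fin x.numColors, {v | x.source v = c}.ncard = {v | x.target v = c}.ncard

/-- The instance obtained by removing the vertex `w` and restricting both colorings. -/
def deleteVertex (x : CRCSInstance V) (w : V) : CRCSInstance ↥({w}ᶜ : Set V) where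
  graph := x.graph.induce {w}ᶜ
  numColors := x.numColors
  numColors_pos := x.numColors_pos
  source := x.source.comp (SimpleGraph.Embedding.induce ({w}ᶜ : Set V)).toHom
  target := x.target.comp (SimpleGraph.Embedding.induce ({w}ᶜ : Set V)).toHom

/-- The first reduction rule (return NO) applies to the vertices `a`, `b` of the independent part
`I`: they are twins with the same initial color, one of which changes its color. -/
def Rule1Applies (x : CRCSInstance V) (I : Set V) (a b : V) : Prop :=
  a ∈ I ∧ b ∈ I ∧ a ≠ b ∧ x.graph.neighborSet a = x.graph.neighborSet b ∧
    x.source a = x.source b ∧ (x.source a ≠ x.target a ∨ x.source b ≠ x.target b)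

/-- The second reduction rule (delete `w`) applies to the vertices `a`, `b`, `w` of the independent
part `I`: they are three distinct twins with the same initial color. -/
def Rule2Applies (x : CRCSInstance V) (I : Set V) (a b w : V) : Prop :=
  a ∈ I ∧ b ∈ I ∧ w ∈ I ∧ a ≠ b ∧ a ≠ w ∧ b ≠ w ∧
    x.graph.neighborSet a = x.graph.neighborSet b ∧
    x.graph.neighborSet b = x.graph.neighborSet w ∧
    x.source a = x.source b ∧ x.source b = x.source w

end CRCSInstance

/-- A parameterized problem, with its instances encoded as words over a finite alphabet. -/
structure ParameterizedProblem where
  Instance : Type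
  Alphabet : Type
  [alphabetFintype : Fintype Alphabet]
  encode : Instance → List Alphabet
  encode_injective : Function.Injective encode
  IsYes : Instance → Prop
  parameter : Instance → ℕ

/-- `K` is a kernelization algorithm for `Q`: it is computed by a Turing machine in time polynomial
in the length of the input word, it maps each instance to an equivalent instance of `Q`, and the
size of the output, parameter included, is at most a computable function of the input parameter. -/
structure ParameterizedProblem.IsKernelization (Q : ParameterizedProblem)
    (K : Q.Instance → Q.Instance) : Prop where
  polyTime : Nonempty (Turing.TM2ComputableInPolyTime Q.encode Q.encode K)
  equivalent : ∀ x, Q.IsYes (K x) ↔ Q.IsYes x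
  size_le : ∃ h : ℕ → ℕ, Computable h ∧
    ∀ x, (Q.encode (K x)).length + Q.parameter (K x) ≤ h (Q.parameter x)

/-- An instance of CRCS on a split graph with vertex set `Fin numVertices`. -/
structure SplitCRCSInstance where
  numVertices : ℕ
  toInstance : CRCSInstance (Fin numVertices)
  isSplit : IsSplitGraph toInstance.graph

/-- Concatenation of binary words, each of them followed by the separator `none`. -/
def joinWords (l : List (List Bool)) : List (Option Bool) :=
  l.flatMap fun t => t.map some ++ [none]

theorem joinWords_injective : Function.Injective joinWords := by
  have key : ∀ (s t : List Bool) (p q : List (Option Bool)),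
      s.map some ++ none :: p = t.map some ++ none :: q → s = t ∧ p = q := by
    intro s
    induction s with
    | nil => intro t p q h; cases t <;> simp_all
    | cons a s ih =>
      intro t p q h
      cases t with
      | nil => simp at h
      | cons b t =>
        simp only [List.map_cons, List.cons_append, List.cons.injEq, Option.some.injEq] at h
        obtain ⟨h1, h2⟩ := ih t p q h.2
        exact ⟨by rw [h.1, h1], h2⟩
  intro l
  induction l with
  | nil => intro m h; cases m <;> simp_all [joinWords]
  | cons s l ih =>
    intro m h
    cases m with
    | nil => simp [joinWords] at h
    | cons t m =>
      simp only [joinWords, List.flatMap_cons, List.append_assoc, List.singleton_append] at h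
      obtain ⟨h1, h2⟩ := key _ _ _ _ h
      rw [h1, ih h2]

namespace SplitCRCSInstance

open Classical in
/-- The data of a vertex: its row of the adjacency matrix and its two colors in binary. -/
noncomputable def vertexWords (x : SplitCRCSInstance) (v : Fin x.numVertices) : List (List Bool) :=
  [List.ofFn fun w => decide (x.toInstance.graph.Adj v w),
    encodeNat (x.toInstance.source v), encodeNat (x.toInstance.target v)]

/-- An instance is encoded by the number of colors in binary, followed by the data of each vertex. -/
noncomputable def encode (x : SplitCRCSInstance) : List (Option Bool) :=
  joinWords (encodeNat x.toInstance.numColors :: (List.ofFn x.vertexWords).flatten)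

theorem encodeNat_inj {a b : ℕ} (h : encodeNat a = encodeNat b) : a = b := by
  rw [← decode_encodeNat a, h, decode_encodeNat]

theorem encode_injective : Function.Injective encode := by
  have key : ∀ (l m : List (List (List Bool))), (∀ a ∈ l, a.length = 3) →
      (∀ a ∈ m, a.length = 3) → l.flatten = m.flatten → l = m := by
    intro l
    induction l with
    | nil =>
      intro m _ hm h
      cases m with
      | nil => rfl
      | cons b m =>
        have hb := hm b (by simp)
        have := congrArg List.length h
        simp [hb] at this
        omega
    | cons a l ih =>
      intro m hl hm h
      cases m with
      | nil =>
        have ha := hl a (by simp)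
        have := congrArg List.length h
        simp [ha] at this
      | cons b m =>
        simp only [List.flatten_cons] at h
        obtain ⟨h1, h2⟩ := List.append_inj h ((hl a (by simp)).trans (hm b (by simp)).symm)
        rw [h1, ih m (fun c hc => hl c (by simp [hc])) (fun c hc => hm c (by simp [hc])) h2]
  rintro ⟨n, ⟨G, k, hk, f, g⟩, hx⟩ ⟨n', ⟨G', k', hk', f', g'⟩, hx'⟩ h
  have h := joinWords_injective h
  simp only [List.cons.injEq] at h
  obtain ⟨h1, h2⟩ := h
  have hkk := encodeNat_inj h1
  subst hkk
  have h3 := key _ _ (by simp [List.mem_ofFn, vertexWords]) (by simp [List.mem_ofFn, vertexWords]) h2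
  have hnn : n = n' := by simpa using congrArg List.length h3
  subst hnn
  have h4 := List.ofFn_injective h3
  have h5 : ∀ v, _ := fun v => congrFun h4 v
  simp only [vertexWords, List.cons.injEq, and_true] at h5
  have hG : G = G' := by
    ext v w
    have := congrFun (List.ofFn_injective (h5 v).1) w
    simpa using this
  subst hG
  have hf : f = f' := by
    ext v
    exact encodeNat_inj (h5 v).2.1
  have hg : g = g' := by
    ext v
    exact encodeNat_inj (h5 v).2.2
  subst hf hg
  rfl

end SplitCRCSInstance

/-- CRCS on split graphs, parameterized by the number of colors. -/
noncomputable def splitCRCS : ParameterizedProblem where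
  Instance := SplitCRCSInstance
  Alphabet := Option Bool
  encode := SplitCRCSInstance.encode
  encode_injective := SplitCRCSInstance.encode_injective
  IsYes x := x.toInstance.IsYes
  parameter x := x.toInstance.numColors

/-!
A vertex with a colored twin, i.e. a vertex with the same neighbors and the same color, never
changes its color: it could only be swapped with a neighbor, and this neighbor would take over the
color that the twin still carries. Hence, as long as two colored twins of each deleted vertex are
kept and no deleted vertex is to change its color, deleting vertices does not affect
reconfigurability: retracting each deleted vertex to a kept colored twin turns reconfiguration
sequences of the smaller graph into reconfiguration sequences of the full graph. The colors being
pairwise distinct on the clique, a vertex of the independent part is determined up to colored twins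
by its color and the set of the colors of its neighbors. So if at most two vertices of each class
are kept, then at most `k + 2 * k * 2 ^ k` vertices remain.

The kernelization machine compares the row and the initial color of each vertex with those of the
earlier vertices, marks the vertices with fewer than two earlier colored twins, and copies the
marked columns of the marked rows, unless an unmarked vertex is to change its color.
-/

universe v

section Twins

variable {V : Type u} {V' : Type v} {α : Type*} {G : SimpleGraph V}

/-- Two vertices with the same neighbors and the same color. -/
def ColoredTwins (f : G.Coloring α) (a b : V) : Prop :=
  G.neighborSet a = G.neighborSet b ∧ f a = f b

namespace ColoredTwins

variable {f : G.Coloring α} {a b c : V}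

theorem symm (h : ColoredTwins f a b) : ColoredTwins f b a :=
  ⟨h.1.symm, h.2.symm⟩

theorem trans (hab : ColoredTwins f a b) (hbc : ColoredTwins f b c) : ColoredTwins f a c :=
  ⟨hab.1.trans hbc.1, hab.2.trans hbc.2⟩

theorem adj_iff (h : ColoredTwins f a b) : G.Adj a c ↔ G.Adj b c :=
  Set.ext_iff.1 h.1 c

end ColoredTwins

variable {k : ℕ} {f g t : G.Coloring (Fin k)} {a b : V}

theorem ColorSwapAdj.eq_of_coloredTwins (h : ColorSwapAdj f g) (hab : a ≠ b)
    (twins : ColoredTwins f a b) : g a = f a := by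
  obtain ⟨p, q, hpq, hp, hq, hne⟩ := h
  -- If `a` were on the swapped edge, its twin would keep a color that moves to a neighbor.
  have key : ∀ p q : V, G.Adj p q → f p = g q → (∀ w, w ≠ p → w ≠ q → f w = g w) → a ≠ p := by
    rintro p q hpq hp hne rfl
    have hbq : G.Adj b q := twins.adj_iff.1 hpq
    exact g.valid hbq ((hne b hab.symm hbq.ne).symm.trans (twins.2.symm.trans hp))
  exact (hne a (key p q hpq hp hne)
    (key q p hpq.symm hq fun w hwq hwp => hne w hwp hwq)).symm

theorem Reconfigurable.eq_of_coloredTwins (h : Reconfigurable f g) (hab : a ≠ b)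
    (twins : ColoredTwins f a b) : g a = f a := by
  suffices g a = f a ∧ g b = f b from this.1
  induction h with
  | refl => exact ⟨rfl, rfl⟩
  | tail _ h ih =>
    have twins' := And.intro twins.1 (ih.1.trans (twins.2.trans ih.2.symm))
    exact ⟨(h.eq_of_coloredTwins hab twins').trans ih.1,
      (h.eq_of_coloredTwins hab.symm (ColoredTwins.symm twins')).trans ih.2⟩

/-- The restriction of a coloring along an embedding of vertex sets. -/
def restrictColoring (f : G.Coloring α) (e : V' ↪ V) : (G.comap e).Coloring α :=
  f.comp (SimpleGraph.Embedding.comap e G).toHom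

theorem ColoredTwins.restrict {f : G.Coloring α} {e : V' ↪ V} {a b : V'}
    (h : ColoredTwins f (e a) (e b)) : ColoredTwins (restrictColoring f e) a b :=
  ⟨by rw [G.neighborSet_comap, G.neighborSet_comap, h.1], h.2⟩

/-- Each vertex outside of the range of `e` has two colored twins in the range of `e`. -/
def TwinsKept (f : G.Coloring α) (e : V' ↪ V) : Prop :=
  ∀ w ∉ Set.range e, ∃ a b : V', a ≠ b ∧ ColoredTwins f (e a) w ∧ ColoredTwins f (e b) w

theorem TwinsKept.exists_retraction {f : G.Coloring α} {e : V' ↪ V} (h : TwinsKept f e) :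
    ∃ ρ : G →g G.comap e, (∀ a, ρ (e a) = a) ∧ ∀ v, ColoredTwins f (e (ρ v)) v := by
  have exists_twin (v : V) : ∃ a : V', (∀ b, e b = v → a = b) ∧ ColoredTwins f (e a) v := by
    by_cases hv : v ∈ Set.range e
    · obtain ⟨a, rfl⟩ := hv
      exact ⟨a, fun b hb => e.injective hb.symm, rfl, rfl⟩
    · obtain ⟨a, -, -, ha, -⟩ := h v hv
      exact ⟨a, fun b hb => (hv ⟨b, hb⟩).elim, ha⟩
  choose ρ hρ twins using exists_twin
  refine ⟨⟨ρ, fun {v w} hvw => ?_⟩, fun a => hρ (e a) a rfl, twins⟩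
  exact (twins v).adj_iff.2 ((twins w).adj_iff.2 hvw.symm).symm

theorem Reconfigurable.apply_eq_of_coloredTwins {e : V' ↪ V} (kept : TwinsKept f e)
    {g : (G.comap e).Coloring (Fin k)} (h : Reconfigurable (restrictColoring f e) g) {w : V}
    (hw : w ∉ Set.range e) {c : V'} (twins : ColoredTwins f (e c) w) : g c = f w := by
  obtain ⟨a, b, hab, ha, hb⟩ := kept w hw
  obtain ⟨d, hcd, hd⟩ : ∃ d, c ≠ d ∧ ColoredTwins f (e d) w := by
    by_cases hca : c = a
    · exact ⟨b, hca.trans_ne hab, hb⟩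
    · exact ⟨a, hca, ha⟩
  exact (h.eq_of_coloredTwins hcd (twins.trans hd.symm).restrict).trans twins.2

theorem Reconfigurable.comp_retraction {e : V' ↪ V} (kept : TwinsKept f e) {ρ : G →g G.comap e}
    (hρ : ∀ a, ρ (e a) = a) (twins : ∀ v, ColoredTwins f (e (ρ v)) v)
    {g : (G.comap e).Coloring (Fin k)} (h : Reconfigurable (restrictColoring f e) g) :
    Reconfigurable f (g.comp ρ) := by
  induction h with
  | refl =>
    have : (restrictColoring f e).comp ρ = f := RelHom.ext fun v => (twins v).2
    rw [this]
    exact .refl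
  | @tail g g' hg hgg' ih =>
    refine ih.tail ?_
    obtain ⟨p, q, hpq, hp, hq, hne⟩ := id hgg'
    refine ⟨e p, e q, hpq, ?_, ?_, fun w hwp hwq => ?_⟩
    · simpa [hρ] using hp
    · simpa [hρ] using hq
    · by_cases hw : w ∈ Set.range e
      · obtain ⟨a, rfl⟩ := hw
        simpa [hρ] using hne a (ne_of_apply_ne e hwp) (ne_of_apply_ne e hwq)
      · exact (apply_eq_of_coloredTwins kept hg hw (twins w)).trans
          (apply_eq_of_coloredTwins kept (hg.tail hgg') hw (twins w)).symm

theorem Reconfigurable.restrict {e : V' ↪ V} (kept : TwinsKept f e)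
    (h : Reconfigurable f g) :
    Reconfigurable (restrictColoring f e) (restrictColoring g e) := by
  induction h with
  | refl => exact .refl
  | @tail g g' hg hgg' ih =>
    refine ih.tail ?_
    have fixed : ∀ w ∉ Set.range e, g' w = g w := by
      intro w hw
      obtain ⟨a, _, _, ha, _⟩ := kept w hw
      have hwa : w ≠ e a := fun h => hw ⟨a, h.symm⟩
      exact (eq_of_coloredTwins (hg.tail hgg') hwa ha.symm).trans
        (eq_of_coloredTwins hg hwa ha.symm).symm
    obtain ⟨p, q, hpq, hp, hq, hne⟩ := hgg'
    have mem_range : ∀ p q, G.Adj p q → g q = g' p → p ∈ Set.range e := by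
      intro p q hpq hq
      by_contra hp
      exact g.valid hpq ((fixed p hp).symm.trans hq.symm)
    obtain ⟨p, rfl⟩ := mem_range p q hpq hq
    obtain ⟨q, rfl⟩ := mem_range q _ hpq.symm hp
    exact ⟨p, q, hpq, hp, hq, fun w hwp hwq =>
      hne (e w) (e.injective.ne hwp) (e.injective.ne hwq)⟩

theorem reconfigurable_restrictColoring_iff {e : V' ↪ V} (kept : TwinsKept f e)
    (hft : ∀ w ∉ Set.range e, f w = t w) :
    Reconfigurable (restrictColoring f e) (restrictColoring t e) ↔ Reconfigurable f t := by
  refine ⟨fun h => ?_, fun h => h.restrict kept⟩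
  obtain ⟨ρ, hρ, twins⟩ := kept.exists_retraction
  have : (restrictColoring t e).comp ρ = t := by
    ext v : 1
    by_cases hv : v ∈ Set.range e
    · obtain ⟨a, rfl⟩ := hv
      exact congrArg (restrictColoring t e) (hρ a)
    · exact (h.apply_eq_of_coloredTwins kept hv (twins v)).trans (hft v hv)
  exact this ▸ h.comp_retraction kept hρ twins

end Twins

section Split

variable {V : Type u} {V' : Type v} {α : Type*} {G : SimpleGraph V} {C I : Set V}

theorem IsSplitPartition.comap (h : IsSplitPartition G C I) (e : V' ↪ V) :
    IsSplitPartition (G.comap e) (e ⁻¹' C) (e ⁻¹' I) where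
  clique _ ha _ hb hab := h.clique ha hb (e.injective.ne hab)
  indep _ ha _ hb hab := h.indep ha hb (e.injective.ne hab)
  disjoint := h.disjoint.preimage e
  union_eq := by rw [← Set.preimage_union, h.union_eq, Set.preimage_univ]

theorem IsSplitPartition.mem_indep (h : IsSplitPartition G C I) {v : V} (hv : v ∉ C) : v ∈ I :=
  ((Set.ext_iff.1 h.union_eq v).2 trivial).resolve_left hv

theorem IsSplitPartition.neighborSet_subset (h : IsSplitPartition G C I) {v : V} (hv : v ∉ C) :
    G.neighborSet v ⊆ C := fun _ hvw =>
  by_contra fun hw => h.indep (h.mem_indep hv) (h.mem_indep hw) hvw.ne hvw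

theorem injOn_coloring_of_isClique (hC : G.IsClique C) (f : G.Coloring α) : Set.InjOn f C :=
  fun _ ha _ hb hab => by_contra fun hne => f.valid (hC ha hb hne) hab

theorem IsSplitPartition.coloredTwins (h : IsSplitPartition G C I) {f : G.Coloring α} {v w : V}
    (hv : v ∉ C) (hw : w ∉ C) (hcolor : f v = f w)
    (hcolors : f '' G.neighborSet v = f '' G.neighborSet w) : ColoredTwins f v w :=
  ⟨((injOn_coloring_of_isClique h.clique f).image_eq_image_iff (h.neighborSet_subset hv)
    (h.neighborSet_subset hw)).1 hcolors, hcolor⟩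

theorem IsSplitPartition.card_le_of_coloredTwins [Fintype α] (h : IsSplitPartition G C I)
    (f : G.Coloring α) {m : ℕ} (s : Finset V)
    (hs : ∀ t ⊆ s, (∀ a ∈ t, ∀ b ∈ t, ColoredTwins f a b) → t.card ≤ m) :
    s.card ≤ Fintype.card α + m * (Fintype.card α * 2 ^ Fintype.card α) := by
  classical
  rw [← Finset.card_filter_add_card_filter_not (s := s) (· ∈ C)]
  have clique_le : (s.filter (· ∈ C)).card ≤ Fintype.card α :=
    SimpleGraph.IsClique.card_le_of_coloring
      (h.clique.subset fun v hv => (Finset.mem_filter.1 hv).2) f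
  let signature (v : V) : α × Set α := (f v, f '' G.neighborSet v)
  have indep_le : (s.filter (· ∉ C)).card ≤ m * ((s.filter (· ∉ C)).image signature).card := by
    refine Finset.card_le_mul_card_image _ m fun y _ => hs _ (by grind) fun a ha b hb => ?_
    simp only [Finset.mem_filter] at ha hb
    obtain ⟨hcolor, hcolors⟩ := Prod.ext_iff.1 (ha.2.trans hb.2.symm)
    exact h.coloredTwins ha.1.2 hb.1.2 hcolor hcolors
  refine add_le_add clique_le (indep_le.trans (Nat.mul_le_mul_left m ?_))
  exact (Finset.card_le_univ _).trans (by rw [Fintype.card_prod, Fintype.card_set])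

end Split

namespace CRCSInstance

variable {V : Type u} {V' : Type v} (x : CRCSInstance V) (e : V' ↪ V)

/-- The instance induced along an embedding of vertex sets. -/
def restrict : CRCSInstance V' where
  graph := x.graph.comap e
  numColors := x.numColors
  numColors_pos := x.numColors_pos
  source := restrictColoring x.source e
  target := restrictColoring x.target e

variable {x e}

theorem isYes_restrict_iff (kept : TwinsKept x.source e)
    (fixed : ∀ w ∉ Set.range e, x.source w = x.target w) : (x.restrict e).IsYes ↔ x.IsYes :=
  reconfigurable_restrictColoring_iff kept fixed

theorem IsValid.restrict [Finite V] (hx : x.IsValid)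
    (fixed : ∀ w ∉ Set.range e, x.source w = x.target w) : (x.restrict e).IsValid := by
  intro c
  have ncard_restrict (f : V → Fin x.numColors) : {a | f (e a) = c}.ncard +
      ({v | f v = c} \ Set.range e).ncard = {v | f v = c}.ncard := by
    rw [← Set.ncard_inter_add_ncard_sdiff_eq_ncard {v | f v = c} (Set.range e),
      ← Set.image_preimage_eq_inter_range, Set.ncard_image_of_injective _ e.injective]
    rfl
  have diff_eq : {v | x.source v = c} \ Set.range e = {v | x.target v = c} \ Set.range e :=
    Set.ext fun v => and_congr_left fun hv => by simp [fixed v hv]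
  have source_eq := ncard_restrict x.source
  have target_eq := ncard_restrict x.target
  rw [diff_eq, hx c, ← target_eq] at source_eq
  exact Nat.add_right_cancel source_eq

theorem not_isYes_of_coloredTwins {a b : V} (hab : a ≠ b) (twins : ColoredTwins x.source a b)
    (moved : x.source a ≠ x.target a) : ¬ x.IsYes := fun h =>
  moved (h.eq_of_coloredTwins hab twins).symm

theorem Rule1Applies.not_isYes {I : Set V} {a b : V} (h : x.Rule1Applies I a b) : ¬ x.IsYes := by
  obtain ⟨-, -, hab, hN, hcolor, moved | moved⟩ := h
  · exact not_isYes_of_coloredTwins hab ⟨hN, hcolor⟩ moved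
  · exact not_isYes_of_coloredTwins hab.symm ⟨hN.symm, hcolor.symm⟩ moved

theorem deleteVertex_eq_restrict (w : V) :
    x.deleteVertex w = x.restrict (Function.Embedding.subtype (· ∈ ({w}ᶜ : Set V))) := rfl

theorem eq_of_notMem_range_subtype_compl {v w : V}
    (h : v ∉ Set.range (Function.Embedding.subtype (· ∈ ({w}ᶜ : Set V)))) : v = w :=
  by_contra fun hv => h ⟨⟨v, hv⟩, rfl⟩

section Rule2

variable {I : Set V} {a b w : V}

theorem Rule2Applies.source_eq_target (h : x.Rule2Applies I a b w)
    (rule1 : ∀ a b, ¬ x.Rule1Applies I a b) : x.source w = x.target w := by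
  obtain ⟨-, hb, hw, -, -, hbw, -, hN, -, hcolor⟩ := h
  by_contra moved
  exact rule1 b w ⟨hb, hw, hbw, hN, hcolor, .inr moved⟩

theorem Rule2Applies.fixed (h : x.Rule2Applies I a b w) (rule1 : ∀ a b, ¬ x.Rule1Applies I a b) :
    ∀ v ∉ Set.range (Function.Embedding.subtype (· ∈ ({w}ᶜ : Set V))),
      x.source v = x.target v := fun _ hv =>
  eq_of_notMem_range_subtype_compl hv ▸ h.source_eq_target rule1

theorem Rule2Applies.twinsKept (h : x.Rule2Applies I a b w) :
    TwinsKept x.source (Function.Embedding.subtype (· ∈ ({w}ᶜ : Set V))) := by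
  intro v hv
  obtain rfl := eq_of_notMem_range_subtype_compl hv
  obtain ⟨-, -, -, hab, hav, hbv, hN, hN', hcolor, hcolor'⟩ := h
  exact ⟨⟨a, hav⟩, ⟨b, hbv⟩, fun h => hab (congrArg Subtype.val h),
    ⟨hN.trans hN', hcolor.trans hcolor'⟩, hN', hcolor'⟩

end Rule2

end CRCSInstance

section Redundant

variable {V : Type u} {α : Type*} {G : SimpleGraph V} {f : G.Coloring α} {w : V}

/-- In a fixed order of the vertices, all but the first two vertices of each class of colored twins
are redundant: `v` is redundant if at least two colored twins precede it. -/
def IsRedundant [Preorder V] (f : G.Coloring α) (v : V) : Prop :=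
  {a | a < v ∧ ColoredTwins f a v}.Nontrivial

theorem IsRedundant.exists_not_isRedundant [Preorder V] [WellFoundedLT V]
    (h : IsRedundant f w) : ∃ a b, a ≠ b ∧ ¬ IsRedundant f a ∧ ¬ IsRedundant f b ∧
      ColoredTwins f a w ∧ ColoredTwins f b w := by
  have twins_nontrivial : {v | ColoredTwins f v w}.Nontrivial := h.mono fun _ hv => hv.2
  obtain ⟨a, ha, a_le⟩ := exists_minimal_of_wellFoundedLT _ twins_nontrivial.nonempty
  obtain ⟨c, hc, hca⟩ := twins_nontrivial.exists_ne a
  obtain ⟨b, ⟨hb, hba⟩, b_le⟩ :=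
    exists_minimal_of_wellFoundedLT (fun v => ColoredTwins f v w ∧ v ≠ a) ⟨c, hc, hca⟩
  have eq_of_lt {v} (hv : v < b ∧ ColoredTwins f v b) : v = a :=
    by_contra fun hva => hv.1.not_ge (b_le ⟨hv.2.trans hb, hva⟩ hv.1.le)
  refine ⟨a, b, hba.symm, ?_, ?_, ha, hb⟩
  · rintro ⟨v, ⟨hv, twins⟩, -⟩
    exact hv.not_ge (a_le (twins.trans ha) hv.le)
  · rintro ⟨u, hu, v, hv, huv⟩
    exact huv ((eq_of_lt hu).trans (eq_of_lt hv).symm)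

theorem card_le_two_of_not_isRedundant [LinearOrder V] {t : Finset V}
    (ht : ∀ v ∈ t, ¬ IsRedundant f v) (twins : ∀ a ∈ t, ∀ b ∈ t, ColoredTwins f a b) :
    t.card ≤ 2 := by
  by_contra! card_lt
  let v := t.orderEmbOfFin rfl
  have hv (i : Fin t.card) : v i ∈ t := t.orderEmbOfFin_mem rfl i
  have lt_two {i : ℕ} (hi : i < 2) : v ⟨i, hi.trans card_lt⟩ < v ⟨2, card_lt⟩ :=
    v.strictMono hi
  exact ht _ (hv ⟨2, card_lt⟩) ⟨_, ⟨lt_two zero_lt_two, twins _ (hv _) _ (hv _)⟩,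
    _, ⟨lt_two one_lt_two, twins _ (hv _) _ (hv _)⟩, v.injective.ne (by simp)⟩

end Redundant

/-- Structured programs over stacks indexed by `K` with symbols from `W`: `popCase k f` pops a
symbol `o` (`none` if the stack is empty) from `k` and runs `f o`; `loop k quit f` repeats this
until `quit o` holds. -/
inductive StackProg (K W : Type) : Type
  | skip : StackProg K W
  | push (k : K) (a : W) : StackProg K W
  | seq (p q : StackProg K W) : StackProg K W
  | popCase (k : K) (f : Option W → StackProg K W) : StackProg K W
  | loop (k : K) (quit : Option W → Bool) (f : Option W → StackProg K W) : StackProg K W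

namespace StackProg

notation:60 p:61 " ;; " q:60 => StackProg.seq p q

section Semantics

variable {K W : Type}

/-- The control states needed for running a program. -/
def Label : StackProg K W → Type
  | skip => Unit
  | push _ _ => Unit
  | seq p q => Label p ⊕ Label q
  | popCase _ f => Option (Σ o, Label (f o))
  | loop _ _ f => Option (Σ o, Label (f o))

/-- The control state in which a program starts. -/
def entry : (p : StackProg K W) → Label p
  | skip => ()
  | push _ _ => ()
  | seq p _ => Sum.inl (entry p)
  | popCase _ _ => none
  | loop _ _ _ => none

theorem finite_label [Finite W] (p : StackProg K W) : Finite p.Label := by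
  induction p with
  | skip => exact inferInstanceAs (Finite Unit)
  | push => exact inferInstanceAs (Finite Unit)
  | seq p q hp hq => exact inferInstanceAs (Finite (Label p ⊕ Label q))
  | popCase _ f h => exact inferInstanceAs (Finite (Option (Σ o, Label (f o))))
  | loop _ _ f h => exact inferInstanceAs (Finite (Option (Σ o, Label (f o))))

/-- The code of a program as a part of a machine whose labels contain those of the program via `ι`
and which continues at `exit`. The internal state of the machine holds the last symbol popped. -/
def toStmt {Λ : Type} : (p : StackProg K W) → (Label p → Λ) → Λ → Label p →
    Turing.TM2.Stmt (fun _ : K => W) Λ (Option W)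
  | skip, _, exit, _ => .goto fun _ => exit
  | push k a, _, exit, _ => .push k (fun _ => a) (.goto fun _ => exit)
  | seq p q, ι, exit, l =>
    match l with
    | Sum.inl l => toStmt p (fun l => ι (Sum.inl l)) (ι (Sum.inr (entry q))) l
    | Sum.inr l => toStmt q (fun l => ι (Sum.inr l)) exit l
  | popCase k f, ι, exit, l =>
    match l with
    | none => .pop k (fun _ o => o) (.goto fun o => ι (some ⟨o, entry (f o)⟩))
    | some ⟨o, l⟩ => toStmt (f o) (fun l => ι (some ⟨o, l⟩)) exit l
  | loop k quit f, ι, exit, l =>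
    match l with
    | none => .pop k (fun _ o => o)
        (.goto fun o => bif quit o then exit else ι (some ⟨o, entry (f o)⟩))
    | some ⟨o, l⟩ => toStmt (f o) (fun l => ι (some ⟨o, l⟩)) (ι none) l

variable [DecidableEq K]

/-- `Runs p S S' T`: started with the stacks `S`, the program `p` terminates within `T` steps with
the stacks `S'`. -/
inductive Runs : StackProg K W → (K → List W) → (K → List W) → ℕ → Prop
  | skip (S) : Runs skip S S 1
  | push (k a S) : Runs (push k a) S (Function.update S k (a :: S k)) 1
  | seq {p q S S' S'' T T'} : Runs p S S' T → Runs q S' S'' T' → Runs (seq p q) S S'' (T + T')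
  | popCase {k f S S' T} : Runs (f (S k).head?) (Function.update S k (S k).tail) S' T →
      Runs (popCase k f) S S' (T + 1)
  | loop_exit {k quit f S} : quit (S k).head? = true →
      Runs (loop k quit f) S (Function.update S k (S k).tail) 1
  | loop_step {k quit f S S' S'' T T'} : quit (S k).head? = false →
      Runs (f (S k).head?) (Function.update S k (S k).tail) S' T →
      Runs (loop k quit f) S' S'' T' → Runs (loop k quit f) S S'' (T + T' + 1)
  | mono {p S S' T T'} : Runs p S S' T → T ≤ T' → Runs p S S' T'

theorem Runs.iterate_step {p : StackProg K W} {S S' : K → List W} {T : ℕ} (h : Runs p S S' T) :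
    ∀ {Λ : Type} (M : Λ → Turing.TM2.Stmt (fun _ : K => W) Λ (Option W)) (ι : Label p → Λ)
      (exit : Λ), (∀ l, M (ι l) = toStmt p ι exit l) → ∀ v, ∃ t ≤ T, ∃ v',
        (flip bind (Turing.TM2.step M))^[t] (some ⟨some (ι (entry p)), v, S⟩) =
          some ⟨some exit, v', S'⟩ := by
  induction h with
  | skip | push =>
    intro Λ M ι exit hM v
    exact ⟨1, le_rfl, v, by simp [flip, hM, toStmt]⟩
  | seq _ _ ih₁ ih₂ =>
    intro Λ M ι exit hM v
    obtain ⟨t₁, ht₁, v₁, h₁⟩ := ih₁ M _ _ (fun l => hM (Sum.inl l)) v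
    obtain ⟨t₂, ht₂, v₂, h₂⟩ := ih₂ M _ _ (fun l => hM (Sum.inr l)) v₁
    refine ⟨t₂ + t₁, by omega, v₂, ?_⟩
    rw [Function.iterate_add_apply]
    exact (congrArg _ h₁).trans h₂
  | @popCase k f S S' T _ ih =>
    intro Λ M ι exit hM v
    obtain ⟨t, ht, v', h⟩ := ih M _ _ (fun l => hM (some ⟨_, l⟩)) (S k).head?
    refine ⟨t + 1, by omega, v', ?_⟩
    rw [Function.iterate_succ_apply, ← h]
    simp [flip, entry, (hM none).trans (by rw [toStmt])]
  | @loop_exit k quit f S hquit =>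
    intro Λ M ι exit hM v
    exact ⟨1, le_rfl, (S k).head?, by
      simp [flip, entry, (hM none).trans (by rw [toStmt]), hquit]⟩
  | @loop_step k quit f S S' S'' T T' hquit _ _ ih₁ ih₂ =>
    intro Λ M ι exit hM v
    obtain ⟨t₁, ht₁, v₁, h₁⟩ := ih₁ M _ _ (fun l => hM (some ⟨_, l⟩)) (S k).head?
    obtain ⟨t₂, ht₂, v₂, h₂⟩ := ih₂ M ι exit hM v₁
    refine ⟨t₂ + t₁ + 1, by omega, v₂, ?_⟩
    rw [Function.iterate_succ_apply, Function.iterate_add_apply, ← h₂]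
    refine congrArg _ (Eq.trans ?_ h₁)
    simp [flip, entry, (hM none).trans (by rw [toStmt]), hquit]
  | mono _ hT ih =>
    intro Λ M ι exit hM v
    obtain ⟨t, ht, h⟩ := ih M ι exit hM v
    exact ⟨t, ht.trans hT, h⟩

/-- A Turing machine running a program, with its input and its output on the stack `k₀`. -/
noncomputable def machine [Fintype K] [Fintype W] (p : StackProg K W) (k₀ : K) :
    Turing.FinTM2 where
  K := K
  k₀ := k₀
  k₁ := k₀
  Γ _ := W
  Λ := Option p.Label
  main := some p.entry
  ΛFin := @Fintype.ofFinite _ (@instFiniteOption _ p.finite_label)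
  σ := Option W
  initialState := none
  m
    | none => .load (fun _ => none) .halt
    | some l => p.toStmt some none l

theorem initList_eq_update (tm : Turing.FinTM2) (s : List (tm.Γ tm.k₀)) :
    Turing.initList tm s =
      ⟨some tm.main, tm.initialState, Function.update (fun _ => []) tm.k₀ s⟩ := by
  unfold Turing.initList
  congr 1
  funext k
  rcases eq_or_ne k tm.k₀ with rfl | hk <;> simp [*]

theorem haltList_eq_update (tm : Turing.FinTM2) (s : List (tm.Γ tm.k₁)) :
    Turing.haltList tm s =
      ⟨none, tm.initialState, Function.update (fun _ => []) tm.k₁ s⟩ := by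
  unfold Turing.haltList
  congr 1
  funext k
  rcases eq_or_ne k tm.k₁ with rfl | hk <;> simp [*]

theorem nonempty_tm2ComputableInPolyTime [Finite K] [Finite W] {α β : Type} {ea : α → List W}
    {eb : β → List W} {f : α → β} (p : StackProg K W) (k₀ : K) (time : Polynomial ℕ)
    (h : ∀ a, p.Runs (Function.update (fun _ => []) k₀ (ea a))
      (Function.update (fun _ => []) k₀ (eb (f a))) (time.eval (ea a).length)) :
    Nonempty (Turing.TM2ComputableInPolyTime ea eb f) := by
  have := Fintype.ofFinite K
  have := Fintype.ofFinite W
  refine ⟨⟨⟨p.machine k₀, Equiv.refl _, Equiv.refl _⟩, time + 1, fun a => ?_⟩⟩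
  choose t ht v hv using (h a).iterate_step (p.machine k₀).m some none (fun _ => rfl)
  have initial_eq : Turing.initList (p.machine k₀) ((ea a).map (Equiv.refl W).invFun) =
      ⟨some (some p.entry), none, Function.update (fun _ => []) k₀ (ea a)⟩ := by
    rw [initList_eq_update]
    exact congrArg (fun l => Turing.TM2.Cfg.mk _ _ (Function.update _ k₀ l)) (List.map_id _)
  have final_eq : Turing.haltList (p.machine k₀) ((eb (f a)).map (Equiv.refl W).invFun) =
      ⟨none, none, Function.update (fun _ => []) k₀ (eb (f a))⟩ := by
    rw [haltList_eq_update]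
    exact congrArg (fun l => Turing.TM2.Cfg.mk _ _ (Function.update _ k₀ l)) (List.map_id _)
  refine ⟨⟨t none + 1, ?_⟩, by simpa using ht none⟩
  refine (Function.iterate_succ_apply' (flip bind (p.machine k₀).step) _ _).trans ?_
  refine (congrArg (fun c => flip bind (p.machine k₀).step
    ((flip bind (p.machine k₀).step)^[t none] (some c))) initial_eq).trans ?_
  exact (congrArg (flip bind (p.machine k₀).step) (hv none)).trans (congrArg some final_eq).symm

theorem Runs.length_le {p : StackProg K W} {S S' : K → List W} {T : ℕ} (h : Runs p S S' T)
    (k : K) : (S' k).length ≤ (S k).length + T := by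
  induction h with
  | skip => omega
  | push k' a S => by_cases hk : k = k' <;> simp [hk]
  | seq => omega
  | @popCase k' _ S S' T _ ih =>
    grind [Function.update_apply]
  | @loop_exit k' =>
    grind [Function.update_apply]
  | @loop_step k' _ _ S S' S'' T T' _ _ _ ih₁ ih₂ =>
    grind [Function.update_apply]
  | mono => omega

theorem Runs.of_eq_of_le {p : StackProg K W} {S S' S'' : K → List W} {T T' : ℕ}
    (h : Runs p S S' T) (hS : S' = S'') (hT : T ≤ T') : Runs p S S'' T' :=
  hS ▸ h.mono hT

end Semantics

section Programs

variable {K W : Type}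

/-- Removes the symbols of the stack `k` one after the other, running `f a` for each symbol `a`. -/
def forEach (k : K) (f : W → StackProg K W) : StackProg K W :=
  loop k Option.isNone fun o => o.elim skip f

/-- Repeats `p` as long as the stack `k` is nonempty. -/
def whileNonempty (k : K) (p : StackProg K W) : StackProg K W :=
  loop k Option.isNone fun o => o.elim skip fun a => push k a ;; p

/-- Pushes the symbols of `w`, so that `w` becomes the top of the stack `k`. -/
def pushAll (k : K) (w : List W) : StackProg K W :=
  w.foldr (fun a p => p ;; push k a) skip

/-- Pushes `a` on each of the stacks `ms`. -/
def pushOn (ms : List K) (a : W) : StackProg K W :=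
  ms.foldr (fun m p => push m a ;; p) skip

/-- Empties the stack `k`, pushing each of its symbols on all the stacks `ms`. -/
def pour (k : K) (ms : List K) : StackProg K W := forEach k (pushOn ms)

/-- Pushes the content of `k` on `m` in the same order, using the empty stack `t`. -/
def copy (k m t : K) : StackProg K W := pour k [t] ;; pour t [k, m]

/-- Pushes the content of `k` on `m` in reverse order, using the empty stack `t`. -/
def copyReverse (k m t : K) : StackProg K W := pour k [t, m] ;; pour t [k]

variable [DecidableEq K] {S S' S'' : K → List W} {T T' : ℕ}

theorem runs_popCase_nil {k : K} {f : Option W → StackProg K W} (hk : S k = [])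
    (h : Runs (f none) S S' T) : Runs (popCase k f) S S' (T + 1) := by
  refine .popCase ?_
  rwa [hk, List.tail_nil, ← hk, Function.update_eq_self, hk]

theorem runs_popCase_cons {k : K} {f : Option W → StackProg K W} {a : W} {l : List W}
    (hk : S k = a :: l) (h : Runs (f (some a)) (Function.update S k l) S' T) :
    Runs (popCase k f) S S' (T + 1) := by
  refine .popCase ?_
  rwa [hk]

theorem runs_loop_exit_nil {k : K} {quit : Option W → Bool} {f : Option W → StackProg K W}
    (hk : S k = []) (hquit : quit none = true) : Runs (loop k quit f) S S 1 := by
  have h := Runs.loop_exit (f := f) (S := S) (k := k) (quit := quit) (by rwa [hk])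
  rwa [hk, List.tail_nil, ← hk, Function.update_eq_self] at h

theorem runs_loop_exit_cons {k : K} {quit : Option W → Bool} {f : Option W → StackProg K W} {a : W}
    {l : List W} (hk : S k = a :: l) (hquit : quit (some a) = true) :
    Runs (loop k quit f) S (Function.update S k l) 1 := by
  have h := Runs.loop_exit (f := f) (S := S) (k := k) (quit := quit) (by rwa [hk])
  rwa [hk] at h

theorem runs_loop_cons {k : K} {quit : Option W → Bool} {f : Option W → StackProg K W} {a : W}
    {l : List W} (hk : S k = a :: l) (hquit : quit (some a) = false)
    (hbody : Runs (f (some a)) (Function.update S k l) S' T)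
    (hloop : Runs (loop k quit f) S' S'' T') : Runs (loop k quit f) S S'' (T + T' + 1) :=
  .loop_step (S' := S') (by rwa [hk]) (by rwa [hk]) hloop

theorem runs_whileNonempty_cons {k : K} {p : StackProg K W} (hk : S k ≠ [])
    (hp : Runs p S S' T) (hloop : Runs (whileNonempty k p) S' S'' T') :
    Runs (whileNonempty k p) S S'' (T + T' + 2) := by
  obtain ⟨a, l, hk⟩ := List.exists_cons_of_ne_nil hk
  refine (runs_loop_cons hk rfl ((Runs.push k a _).seq (?_ : Runs p _ S' T)) hloop).mono
    (by omega)
  rwa [Function.update_self, Function.update_idem, ← hk, Function.update_eq_self]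

theorem runs_pushAll (k : K) (w : List W) :
    Runs (pushAll k w) S (Function.update S k (w ++ S k)) (w.length + 1) := by
  induction w generalizing S with
  | nil => exact (Runs.skip S).of_eq_of_le (by simp) (by simp)
  | cons a w ih => exact (ih.seq (.push k a _)).of_eq_of_le (by simp) (by simp)

theorem runs_pushOn {ms : List K} (hms : ms.Nodup) (a : W) :
    Runs (pushOn ms a) S (fun x => if x ∈ ms then a :: S x else S x) (ms.length + 1) := by
  induction ms generalizing S with
  | nil => exact (Runs.skip S).of_eq_of_le (by simp) (by simp)
  | cons m ms ih =>
    obtain ⟨hm, hms⟩ := List.nodup_cons.1 hms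
    refine ((Runs.push m a S).seq (ih hms)).of_eq_of_le (funext fun x => ?_)
      (by simp only [List.length_cons]; omega)
    grind [Function.update_apply]

theorem runs_pour {k : K} {ms : List K} (hms : (k :: ms).Nodup) :
    Runs (pour k ms) S
      (fun x => if x = k then [] else if x ∈ ms then (S k).reverse ++ S x else S x)
      ((ms.length + 2) * (S k).length + 1) := by
  obtain ⟨hk, hms'⟩ := List.nodup_cons.1 hms
  induction h : S k generalizing S with
  | nil => exact (runs_loop_exit_nil h rfl).of_eq_of_le (funext fun x => by grind) (by simp)
  | cons a l ih =>
    refine (runs_loop_cons h rfl (runs_pushOn hms' a) (ih (by simp [hk]))).of_eq_of_le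
      (funext fun x => ?_) (by simp only [List.length_cons]; lia)
    grind [Function.update_apply]

theorem runs_clear (k : K) :
    Runs (pour k []) S (Function.update S k []) (2 * (S k).length + 1) :=
  (runs_pour (List.nodup_singleton k)).of_eq_of_le
    (funext fun x => by simp [Function.update_apply]) (by simp)

theorem runs_move {k m : K} (hkm : k ≠ m) :
    Runs (pour k [m]) S (Function.update (Function.update S k []) m ((S k).reverse ++ S m))
      (3 * (S k).length + 1) :=
  (runs_pour (by simpa using hkm)).of_eq_of_le
    (funext fun x => by grind [Function.update_apply]) (by simp)

theorem runs_copy {k m t : K} (h : [k, m, t].Nodup) (ht : S t = []) :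
    Runs (copy k m t) S (Function.update S m (S k ++ S m)) (7 * (S k).length + 2) := by
  refine ((runs_pour (ms := [t]) (by grind)).seq (runs_pour (by grind))).of_eq_of_le
    (funext fun x => ?_) (by grind)
  grind [Function.update_apply]

theorem runs_copyReverse {k m t : K} (h : [k, m, t].Nodup) (ht : S t = []) :
    Runs (copyReverse k m t) S (Function.update S m ((S k).reverse ++ S m))
      (7 * (S k).length + 2) := by
  refine ((runs_pour (ms := [t, m]) (by grind)).seq (runs_pour (by grind))).of_eq_of_le
    (funext fun x => ?_) (by grind)
  grind [Function.update_apply]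

end Programs

section Words

variable {K α : Type}

/-- Moves the word on top of `k` to `m`, which reverses it, and removes its separator. -/
def readWord (k m : K) : StackProg K (Option α) :=
  loop k (fun o => o.join.isNone) fun o => push m o.join

/-- Moves the content of `k`, a reversed word, to `m`, followed by a separator. -/
def storeWord (k m : K) : StackProg K (Option α) := push m none ;; pour k [m]

/-- Removes the word on top of `k` and all of `m`, and pushes one symbol on `n` for each position in
which they differ. -/
def compareWord [DecidableEq α] (k m n : K) : StackProg K (Option α) :=
  loop k (fun o => o.join.isNone)
      (fun o => popCase m fun o' => if o = o' then skip else push n none) ;;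
    forEach m fun _ => push n none

/-- The number of positions in which two words differ, the shorter one being continued by blanks. -/
def mismatches [DecidableEq α] : List α → List α → ℕ
  | [], u => u.length
  | w, [] => w.length
  | a :: w, b :: u => mismatches w u + if a = b then 0 else 1

theorem mismatches_eq_zero [DecidableEq α] {w u : List α} : mismatches w u = 0 ↔ w = u := by
  fun_induction mismatches w u <;> grind

theorem mismatches_le [DecidableEq α] (w u : List α) :
    mismatches w u ≤ w.length + u.length := by
  fun_induction mismatches w u <;> grind

theorem mismatches_eq_take [DecidableEq α] (w u : List α) :
    mismatches w u = (u.length - w.length) + mismatches w (u.take w.length) := by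
  fun_induction mismatches w u <;> grind [mismatches]

variable [DecidableEq K] {S : K → List (Option α)}

theorem runs_readWord {k m : K} (hkm : k ≠ m) {w : List α} {rest : List (Option α)}
    (hk : S k = w.map some ++ none :: rest) :
    Runs (readWord k m) S
      (Function.update (Function.update S k rest) m ((w.map some).reverse ++ S m))
      (2 * w.length + 1) := by
  induction w generalizing S with
  | nil =>
    exact (runs_loop_exit_cons hk rfl).of_eq_of_le
      (funext fun x => by grind [Function.update_apply]) (by simp)
  | cons a w ih =>
    refine (runs_loop_cons hk rfl (.push m _ _) (ih (by simp [hkm]))).of_eq_of_le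
      (funext fun x => ?_) (by grind)
    grind [Function.update_apply, Option.join_some]

theorem runs_storeWord {k m : K} (hkm : k ≠ m) {w : List α} (hk : S k = (w.map some).reverse) :
    Runs (storeWord k m) S
      (Function.update (Function.update S k []) m (w.map some ++ none :: S m))
      (3 * w.length + 2) := by
  refine ((Runs.push m none S).seq (runs_move hkm)).of_eq_of_le (funext fun x => ?_) ?_ <;>
  grind [Function.update_apply]

theorem runs_forEach_push (k n : K) (hkn : k ≠ n) (a : Option α) :
    Runs (forEach k fun _ => push n a) S
      (Function.update (Function.update S k []) n (List.replicate (S k).length a ++ S n))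
      (2 * (S k).length + 1) := by
  induction h : S k generalizing S with
  | nil => exact (runs_loop_exit_nil h rfl).of_eq_of_le (funext fun x => by grind) (by simp)
  | cons b l ih =>
    refine (runs_loop_cons h rfl (.push n a _) (ih (by simp [hkn]))).of_eq_of_le
      (funext fun x => ?_) (by simp only [List.length_cons]; lia)
    rw [List.length_cons, List.replicate_succ']
    grind [Function.update_apply]

theorem runs_compareWord_loop [DecidableEq α] {k m n : K} (h : [k, m, n].Nodup) {w u : List α}
    {rest : List (Option α)} (hk : S k = w.map some ++ none :: rest) (hm : S m = u.map some) :
    Runs (loop k (fun o => o.join.isNone)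
        fun o => popCase m fun o' => if o = o' then skip else push n none) S
      (Function.update (Function.update (Function.update S k rest) m ((u.drop w.length).map some))
        n (List.replicate (mismatches w (u.take w.length)) none ++ S n))
      (3 * w.length + 1) := by
  induction w generalizing S u with
  | nil =>
    refine (runs_loop_exit_cons hk rfl).of_eq_of_le (funext fun x => ?_) (by simp)
    grind [Function.update_apply, mismatches]
  | cons a w ih =>
    obtain ⟨hkm, hkn, hmn⟩ : k ≠ m ∧ k ≠ n ∧ m ≠ n := by simpa [and_assoc] using h
    cases u with
    | nil =>
      refine (runs_loop_cons hk rfl (runs_popCase_nil (by simpa [hkm.symm] using hm)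
        (.push n none _)) (ih (u := []) (by simp [hkn]) (by simp [hmn, hkm.symm, hm]))).of_eq_of_le
        (funext fun x => ?_) (by grind)
      have : mismatches w ([] : List α) = w.length := by cases w <;> rfl
      grind [Function.update_apply, mismatches, List.replicate_succ']
    | cons b u =>
      rcases eq_or_ne a b with rfl | hab
      · refine (runs_loop_cons hk rfl (runs_popCase_cons (by simpa [hkm.symm] using hm)
          (by simpa using .skip _)) (ih (u := u) (by simp [hkm]) (by simp))).of_eq_of_le
          (funext fun x => ?_) (by grind)
        grind [Function.update_apply, mismatches]
      · refine (runs_loop_cons hk rfl (runs_popCase_cons (by simpa [hkm.symm] using hm)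
          (by simpa [hab] using .push n none _)) (ih (u := u) (by simp [hkm, hkn])
            (by simp [hmn]))).of_eq_of_le (funext fun x => ?_) (by grind)
        simp only [List.length_cons, List.take_succ_cons, mismatches, if_neg hab,
          List.replicate_succ']
        grind [Function.update_apply]

theorem runs_compareWord [DecidableEq α] {k m n : K} (h : [k, m, n].Nodup) {w u : List α}
    {rest : List (Option α)} (hk : S k = w.map some ++ none :: rest) (hm : S m = u.map some) :
    Runs (compareWord k m n) S
      (Function.update (Function.update (Function.update S k rest) m [])
        n (List.replicate (mismatches w u) none ++ S n))
      (3 * w.length + 2 * u.length + 2) := by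
  have hmn : m ≠ n := by grind
  refine ((runs_compareWord_loop h hk hm).seq (runs_forEach_push m n hmn none)).of_eq_of_le
    (funext fun x => ?_) (by grind)
  simp only [mismatches_eq_take w u, List.replicate_add]
  grind [Function.update_apply]

end Words

end StackProg

/-- The stacks of the kernelization machine. -/
inductive Stk : Type
  | inp | out | prev | scan | row | src | tmp | aux | neq | cnt | bad | mask
  deriving DecidableEq

instance : Fintype Stk where
  elems := {.inp, .out, .prev, .scan, .row, .src, .tmp, .aux, .neq, .cnt, .bad, .mask}
  complete k := by cases k <;> decide

/-- The data of a vertex in the encoding of an instance. -/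
structure VertexRecord where
  row : List Bool
  source : List Bool
  target : List Bool

namespace VertexRecord

/-- The words encoding a vertex, in the order used by `SplitCRCSInstance.vertexWords`. -/
def words (r : VertexRecord) : List (List Bool) := [r.row, r.source, r.target]

/-- The encoding of a list of vertices. -/
def encodeList (L : List VertexRecord) : List (Option Bool) := joinWords (L.flatMap words)

/-- The number of symbols encoding a vertex. -/
def size (r : VertexRecord) : ℕ := r.row.length + r.source.length + r.target.length + 3

/-- Two vertices have the same neighbors and the same initial color. -/
def twin (r w : VertexRecord) : Bool := decide (w.row = r.row ∧ w.source = r.source)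

/-- For a list of vertices, the latest one first, mark those with fewer than two earlier twins. -/
def marks : List VertexRecord → List Bool
  | [] => []
  | r :: L => decide (L.countP r.twin < 2) :: marks L

/-- Keeps only the marked entries of the row of a vertex. -/
def selectColumns (m : List Bool) (r : VertexRecord) : VertexRecord :=
  { r with row := ((r.row.zip m).filter Prod.snd).map Prod.fst }

theorem encodeList_nil : encodeList [] = [] := rfl

theorem encodeList_cons (r : VertexRecord) (L : List VertexRecord) :
    encodeList (r :: L) = r.row.map some ++ none :: (r.source.map some ++ none ::
      (r.target.map some ++ none :: encodeList L)) := by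
  simp [encodeList, joinWords, words]

theorem encodeList_append (L M : List VertexRecord) :
    encodeList (L ++ M) = encodeList L ++ encodeList M := by
  simp [encodeList, joinWords]

theorem length_encodeList_cons (r : VertexRecord) (L : List VertexRecord) :
    (encodeList (r :: L)).length = r.size + (encodeList L).length := by
  simp only [encodeList_cons, List.length_append, List.length_map, List.length_cons, size]
  omega

theorem length_encodeList_reverse (L : List VertexRecord) :
    (encodeList L.reverse).length = (encodeList L).length := by
  induction L with
  | nil => rfl
  | cons r L ih =>
    rw [List.reverse_cons, encodeList_append, List.length_append, ih, length_encodeList_cons r L,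
      length_encodeList_cons r [], encodeList_nil, List.length_nil, add_zero, add_comm]

theorem length_le_length_encodeList (L : List VertexRecord) :
    L.length ≤ (encodeList L).length := by
  induction L with
  | nil => exact le_rfl
  | cons r L ih => rw [length_encodeList_cons, List.length_cons, size]; omega

theorem length_marks (L : List VertexRecord) : (marks L).length = L.length := by
  induction L with
  | nil => rfl
  | cons r L ih => rw [marks, List.length_cons, List.length_cons, ih]

theorem length_encodeList_le {L : List VertexRecord} {N : ℕ}
    (h : ∀ r ∈ L, r.size ≤ N) : (encodeList L).length ≤ L.length * N := by
  induction L with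
  | nil => simp [encodeList_nil]
  | cons r L ih =>
    rw [List.forall_mem_cons] at h
    rw [length_encodeList_cons, List.length_cons, Nat.succ_mul, add_comm]
    exact add_le_add (ih h.2) h.1

open Classical in
theorem marks_map {V : Type*} [Preorder V] (r : V → VertexRecord) {l : List V}
    (sorted : l.Pairwise (· > ·)) (lower : ∀ v ∈ l, ∀ w < v, w ∈ l) :
    marks (l.map r) =
      l.map fun v => decide (¬ {w | w < v ∧ (r v).twin (r w) = true}.Nontrivial) := by
  induction l with
  | nil => rfl
  | cons v l ih =>
    rw [List.pairwise_cons] at sorted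
    have mem_iff (w : V) : w ∈ l ↔ w < v :=
      ⟨sorted.1 w, fun h => (List.mem_cons.1 (lower v List.mem_cons_self w h)).resolve_left h.ne⟩
    have lower' : ∀ u ∈ l, ∀ w < u, w ∈ l := fun u hu w hw =>
      (mem_iff w).2 (hw.trans ((mem_iff u).1 hu))
    have earlier : ((l.filter fun w => (r v).twin (r w)).toFinset : Set V) =
        {w | w < v ∧ (r v).twin (r w) = true} := by
      ext w
      simp [mem_iff]
    have nodup : (l.filter fun w => (r v).twin (r w)).Nodup :=
      (sorted.2.imp fun h => h.ne').filter _
    have count : l.countP (fun w => (r v).twin (r w)) < 2 ↔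
        ¬ {w | w < v ∧ (r v).twin (r w) = true}.Nontrivial := by
      rw [← earlier, ← Finset.Nontrivial, ← Finset.one_lt_card_iff_nontrivial,
        List.toFinset_card_of_nodup nodup, List.countP_eq_length_filter, not_lt, Nat.lt_succ_iff]
    simp only [List.map_cons, marks, ih sorted.2 lower', List.countP_map, Function.comp_def, count]

end VertexRecord

namespace KernelProg

open StackProg VertexRecord

/-- Compares the next vertex on `scan` with the one on `row` and `src`, recording on `neq` whether
it is not a twin. -/
def compareVertex : StackProg Stk (Option Bool) :=
  copyReverse .row .tmp .aux ;; compareWord .scan .tmp .neq ;;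
  copyReverse .src .tmp .aux ;; compareWord .scan .tmp .neq ;;
  readWord .scan .tmp ;; pour .tmp []

/-- Compares the next vertex on `scan` with the one on `row` and `src`, and counts it on `cnt` if it
is a twin. -/
def scanVertex : StackProg Stk (Option Bool) :=
  compareVertex ;; popCase .neq fun o => o.elim (push .cnt none) fun _ => pour .neq []

/-- Marks a vertex on `mask` if fewer than two twins were counted on `cnt`, and empties `cnt`. -/
def classify : StackProg Stk (Option Bool) :=
  popCase .cnt fun o => o.elim (push .mask (some true)) fun _ =>
  popCase .cnt fun o => o.elim (push .mask (some true)) fun _ =>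
  pour .cnt [] ;; push .mask (some false)

/-- Moves the next vertex from `inp` to `prev`, and marks it if it has fewer than two earlier
twins. -/
def addVertex : StackProg Stk (Option Bool) :=
  readWord .inp .row ;; readWord .inp .src ;; copy .prev .scan .aux ;;
  whileNonempty .scan scanVertex ;; classify ;;
  readWord .inp .tmp ;; storeWord .tmp .prev ;; storeWord .src .prev ;; storeWord .row .prev

/-- Pushes on `inp` the entries of `row` whose column is marked on `tmp`. -/
def selectRow : StackProg Stk (Option Bool) :=
  forEach .row fun a => popCase .tmp fun o => if o = some (some true) then push .inp a else skip

/-- Moves a marked vertex from `prev` to `inp`, restricting its row to the marked columns, and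
removes an unmarked one, recording on `bad` whether it changes its color. -/
def emitVertex : StackProg Stk (Option Bool) :=
  readWord .prev .row ;; readWord .prev .src ;; popCase .scan fun o =>
    if o = some (some true) then
      readWord .prev .tmp ;; storeWord .tmp .inp ;; storeWord .src .inp ;; push .inp none ;;
      copy .mask .tmp .aux ;; selectRow
    else pour .row [] ;; pour .src [.tmp] ;; compareWord .prev .tmp .bad

/-- Replaces the vertices of the instance on `inp` by the marked ones, keeping the number of colors
on `out`. -/
def emitMarked : StackProg Stk (Option Bool) :=
  readWord .inp .out ;; push .out none ;; whileNonempty .inp addVertex ;;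
  copy .mask .scan .aux ;; whileNonempty .prev emitVertex

/-- Replaces an instance by its marked vertices, or by `w` if an unmarked vertex changes its
color. -/
def kernelProg (w : List (Option Bool)) : StackProg Stk (Option Bool) :=
  emitMarked ;; popCase .bad fun o => o.elim (pour .mask [] ;; pour .out [.inp]) fun _ =>
    pour .bad [] ;; pour .mask [] ;; pour .out [] ;; pour .inp [] ;; pushAll .inp w

variable {S : Stk → List (Option Bool)} {r w : VertexRecord} {L R : List VertexRecord}

theorem runs_compareVertex (hscan : S .scan = encodeList (w :: L))
    (hrow : S .row = (r.row.map some).reverse) (hsrc : S .src = (r.source.map some).reverse)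
    (htmp : S .tmp = []) (haux : S .aux = []) (hneq : S .neq = []) :
    Runs compareVertex S
      (Function.update (Function.update S .scan (encodeList L)) .neq
        (List.replicate (mismatches w.row r.row + mismatches w.source r.source) none))
      (9 * r.size + 7 * w.size) := by
  rw [encodeList_cons] at hscan
  have hrow' : (S .row).reverse = r.row.map some := by rw [hrow, List.reverse_reverse]
  have hsrc' : (S .src).reverse = r.source.map some := by rw [hsrc, List.reverse_reverse]
  refine .of_eq_of_le (.seq (runs_copyReverse (by simp) haux) <|
    .seq (runs_compareWord (u := r.row) (by simp) hscan (by simp [hrow', htmp])) <|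
    .seq (runs_copyReverse (by simp) haux) <|
    .seq (runs_compareWord (u := r.source) (by simp) rfl (by simp [hsrc'])) <|
    .seq (runs_readWord (by simp) rfl) (runs_clear _)) (funext fun k => ?_) ?_
  · cases k <;> simp [htmp, hneq, add_comm]
  · simp only [hrow, hsrc, htmp, size, List.length_reverse, List.reverse_reverse, List.append_nil,
      List.length_map, Function.update_self, ne_eq, reduceCtorEq, not_false_eq_true,
      Function.update_of_ne]
    omega

theorem runs_scanVertex (hscan : S .scan = encodeList (w :: L))
    (hrow : S .row = (r.row.map some).reverse) (hsrc : S .src = (r.source.map some).reverse)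
    (htmp : S .tmp = []) (haux : S .aux = []) (hneq : S .neq = []) :
    Runs scanVertex S
      (Function.update (Function.update S .scan (encodeList L)) .cnt
        (if r.twin w then none :: S .cnt else S .cnt))
      (11 * r.size + 9 * w.size) := by
  have compare := runs_compareVertex hscan hrow hsrc htmp haux hneq
  set d := mismatches w.row r.row + mismatches w.source r.source with hd
  have twin_iff : r.twin w ↔ d = 0 := by
    simp [hd, twin, mismatches_eq_zero]
  rcases hd0 : d with _ | d'
  · refine .of_eq_of_le (.seq compare (runs_popCase_nil (by simp [hd0]) (.push _ none _)))
      (funext fun k => ?_) (by simp only [size]; omega)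
    cases k <;> simp [hd0, twin_iff, hneq]
  · have hd_le : d ≤ r.size + w.size := by
      have := mismatches_le w.row r.row
      have := mismatches_le w.source r.source
      simp only [size]
      omega
    refine .of_eq_of_le (.seq compare (runs_popCase_cons (l := List.replicate d' none)
      (by rw [Function.update_self, hd0]; rfl) (runs_clear _))) (funext fun k => ?_) ?_
    · cases k <;> simp [hd0, twin_iff, hneq]
    · rw [Function.update_self, List.length_replicate]
      omega

theorem runs_scanVertices (hscan : S .scan = encodeList L)
    (hrow : S .row = (r.row.map some).reverse) (hsrc : S .src = (r.source.map some).reverse)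
    (htmp : S .tmp = []) (haux : S .aux = []) (hneq : S .neq = []) {N : ℕ} (hr : r.size ≤ N)
    (hL : (encodeList L).length ≤ N) :
    Runs (whileNonempty .scan scanVertex) S
      (Function.update (Function.update S .scan []) .cnt
        (List.replicate (L.countP r.twin) none ++ S .cnt))
      (L.length * (20 * N + 2) + 1) := by
  induction L generalizing S with
  | nil =>
    refine (runs_loop_exit_nil hscan rfl).of_eq_of_le (funext fun k => ?_) (by simp)
    cases k <;> simp [hscan, encodeList_nil]
  | cons w L ih =>
    rw [length_encodeList_cons] at hL
    refine (runs_whileNonempty_cons (by simp [hscan, encodeList_cons])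
      (runs_scanVertex hscan hrow hsrc htmp haux hneq)
      (ih rfl hrow hsrc htmp haux hneq (by omega))).of_eq_of_le (funext fun k => ?_) ?_
    · cases k <;> by_cases h : r.twin w <;>
        simp [h, List.replicate_succ']
    · have : 11 * r.size + 9 * w.size ≤ 20 * N := by omega
      rw [List.length_cons]
      lia

theorem runs_classify {c : ℕ} (hcnt : S .cnt = List.replicate c none) :
    Runs classify S
      (Function.update (Function.update S .cnt []) .mask (some (decide (c < 2)) :: S .mask))
      (2 * c + 5) := by
  match c with
  | 0 =>
    refine .of_eq_of_le (runs_popCase_nil hcnt (.push _ _ _)) (funext fun k => ?_) (by simp)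
    cases k <;> simp [hcnt]
  | 1 =>
    refine .of_eq_of_le (runs_popCase_cons hcnt (runs_popCase_nil rfl (.push _ _ _)))
      (funext fun k => ?_) (by simp)
    cases k <;> simp
  | c + 2 =>
    refine .of_eq_of_le (runs_popCase_cons hcnt (runs_popCase_cons rfl
      (.seq (runs_clear _) (.push _ _ _)))) (funext fun k => ?_)
      (by rw [Function.update_self, List.length_replicate]; omega)
    cases k <;> simp

theorem runs_addVertex (hinp : S .inp = encodeList (r :: R)) (hprev : S .prev = encodeList L)
    (hscan : S .scan = []) (hrow : S .row = []) (hsrc : S .src = []) (htmp : S .tmp = [])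
    (haux : S .aux = []) (hneq : S .neq = []) (hcnt : S .cnt = []) {N : ℕ} (hr : r.size ≤ N)
    (hL : (encodeList L).length ≤ N) :
    Runs addVertex S
      (Function.update (Function.update (Function.update S .inp (encodeList R))
        .prev (encodeList (r :: L))) .mask (some (decide (L.countP r.twin < 2)) :: S .mask))
      (N * (20 * N + 30)) := by
  have hc : L.countP r.twin ≤ L.length := List.countP_le_length
  have hlen : L.length ≤ N := (length_le_length_encodeList L).trans hL
  rw [encodeList_cons] at hinp
  refine .of_eq_of_le (.seq (runs_readWord (by simp) hinp) <|
    .seq (runs_readWord (by simp) rfl) <| .seq (runs_copy (by simp) haux) <|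
    .seq (runs_scanVertices (by simp [hscan, hprev]) (by simp [hrow]) (by simp [hsrc])
      (by simp [htmp]) (by simp [haux]) (by simp [hneq]) hr hL) <|
    .seq (runs_classify (c := L.countP r.twin) (by simp [hcnt])) <|
    .seq (runs_readWord (by simp) rfl) <|
    .seq (runs_storeWord (w := r.target) (by simp) (by simp [htmp])) <|
    .seq (runs_storeWord (w := r.source) (by simp) (by simp [hsrc]))
      (runs_storeWord (w := r.row) (by simp) (by simp [hrow]))) (funext fun k => ?_) ?_
  · cases k <;> simp [hscan, hrow, hsrc, htmp, hcnt, hprev, encodeList_cons]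
  · have : L.length * (20 * N + 2) ≤ N * (20 * N + 2) := Nat.mul_le_mul_right _ hlen
    rw [size] at hr
    simp only [hprev, hsrc, List.append_nil, ne_eq, reduceCtorEq, not_false_eq_true,
      Function.update_of_ne]
    lia

theorem runs_addVertices (hinp : S .inp = encodeList R) (hprev : S .prev = encodeList L)
    (hmask : S .mask = (marks L).map some) (hscan : S .scan = []) (hrow : S .row = [])
    (hsrc : S .src = []) (htmp : S .tmp = []) (haux : S .aux = []) (hneq : S .neq = [])
    (hcnt : S .cnt = []) {N : ℕ} (hN : (encodeList R).length + (encodeList L).length ≤ N) :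
    Runs (whileNonempty .inp addVertex) S
      (Function.update (Function.update (Function.update S .inp [])
        .prev (encodeList (R.reverse ++ L))) .mask ((marks (R.reverse ++ L)).map some))
      (R.length * (N * (20 * N + 30) + 2) + 1) := by
  induction R generalizing S L with
  | nil =>
    refine (runs_loop_exit_nil hinp rfl).of_eq_of_le (funext fun k => ?_) (by simp)
    cases k <;> simp [hinp, hprev, hmask, encodeList_nil]
  | cons r R ih =>
    rw [length_encodeList_cons] at hN
    refine (runs_whileNonempty_cons (by simp [hinp, encodeList_cons])
      (runs_addVertex hinp hprev hscan hrow hsrc htmp haux hneq hcnt (N := N) (by omega)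
        (by omega))
      (ih (L := r :: L) rfl rfl (by simp [hmask, marks]) hscan hrow hsrc htmp haux hneq hcnt
        (by rw [length_encodeList_cons]; omega))).of_eq_of_le (funext fun k => ?_)
      (by rw [List.length_cons]; lia)
    cases k <;> simp

theorem runs_selectRow {p : List (Bool × Bool)} (hrow : S .row = (p.map Prod.fst).map some)
    (htmp : S .tmp = (p.map Prod.snd).map some) :
    Runs selectRow S
      (Function.update (Function.update (Function.update S .row []) .tmp [])
        .inp ((((p.filter Prod.snd).map Prod.fst).map some).reverse ++ S .inp))
      (3 * p.length + 1) := by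
  induction p generalizing S with
  | nil =>
    refine (runs_loop_exit_nil hrow rfl).of_eq_of_le (funext fun k => ?_) (by simp)
    cases k <;> simp_all
  | cons q p ih =>
    obtain ⟨a, b | b⟩ := q
    · refine .of_eq_of_le (runs_loop_cons hrow rfl (runs_popCase_cons htmp (.skip _)) (ih rfl rfl))
        (funext fun k => ?_) (by rw [List.length_cons]; omega)
      cases k <;> simp
    · refine .of_eq_of_le (runs_loop_cons hrow rfl (runs_popCase_cons htmp (.push _ _ _))
        (ih rfl rfl)) (funext fun k => ?_) (by rw [List.length_cons]; omega)
      cases k <;> simp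

theorem runs_emitVertex_marked {m : List Bool} {l : List (Option Bool)}
    (hprev : S .prev = encodeList (r :: L)) (hinp : S .inp = encodeList R)
    (hscan : S .scan = some true :: l) (hmask : S .mask = (m.map some).reverse)
    (hrow : S .row = []) (hsrc : S .src = []) (htmp : S .tmp = []) (haux : S .aux = [])
    (hm : r.row.length = m.length) :
    Runs emitVertex S
      (Function.update (Function.update (Function.update S .prev (encodeList L)) .scan l)
        .inp (encodeList (r.selectColumns m :: R)))
      (12 * r.size) := by
  rw [encodeList_cons] at hprev
  refine .of_eq_of_le (.seq (runs_readWord (by simp) hprev) <|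
    .seq (runs_readWord (by simp) rfl) <| runs_popCase_cons (l := l) hscan <|
    .seq (runs_readWord (by simp) rfl) <|
    .seq (runs_storeWord (w := r.target) (by simp) (by simp [htmp])) <|
    .seq (runs_storeWord (w := r.source) (by simp) (by simp [hsrc])) <|
    .seq (.push _ _ _) <| .seq (runs_copy (by simp) haux) <|
    runs_selectRow (p := (r.row.zip m).reverse) ?_ ?_) (funext fun k => ?_) ?_
  · rw [List.map_reverse, List.map_fst_zip hm.le]
    simp [hrow]
  · rw [List.map_reverse, List.map_snd_zip hm.ge]
    simp [hmask, htmp]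
  · cases k <;> simp [encodeList_cons, selectColumns, hinp, hrow, hsrc, htmp]
  · simp only [hmask, size, List.length_reverse, List.length_map, List.length_zip, ne_eq,
      reduceCtorEq, not_false_eq_true, Function.update_of_ne, Function.update_idem,
      Function.update_self]
    omega

theorem runs_emitVertex_unmarked {l : List (Option Bool)}
    (hprev : S .prev = encodeList (r :: L)) (hscan : S .scan = some false :: l)
    (hrow : S .row = []) (hsrc : S .src = []) (htmp : S .tmp = []) :
    Runs emitVertex S
      (Function.update (Function.update (Function.update S .prev (encodeList L)) .scan l)
        .bad (List.replicate (mismatches r.target r.source) none ++ S .bad))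
      (12 * r.size) := by
  rw [encodeList_cons] at hprev
  refine .of_eq_of_le (.seq (runs_readWord (by simp) hprev) <|
    .seq (runs_readWord (by simp) rfl) <| runs_popCase_cons (l := l) hscan <|
    .seq (runs_clear _) <| .seq (runs_move (by simp)) <|
    runs_compareWord (u := r.source) (by simp) rfl (by simp [hsrc, htmp]))
    (funext fun k => ?_) ?_
  · cases k <;> simp [hrow, hsrc, htmp]
  · simp only [hrow, hsrc, size, List.append_nil, List.length_reverse, List.length_map, ne_eq,
      reduceCtorEq, not_false_eq_true, Function.update_of_ne, Function.update_self]
    omega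

theorem runs_emitVertices {p : List (VertexRecord × Bool)} {m : List Bool}
    (hprev : S .prev = encodeList (p.map Prod.fst)) (hinp : S .inp = encodeList R)
    (hscan : S .scan = p.map fun q => some q.2) (hmask : S .mask = (m.map some).reverse)
    (hrow : S .row = []) (hsrc : S .src = []) (htmp : S .tmp = []) (haux : S .aux = [])
    (hm : ∀ q ∈ p, q.1.row.length = m.length) {N : ℕ}
    (hN : (encodeList (p.map Prod.fst)).length ≤ N) :
    Runs (whileNonempty .prev emitVertex) S
      (Function.update (Function.update (Function.update (Function.update S .prev []) .scan [])
        .inp (encodeList (((p.filter Prod.snd).map fun q => q.1.selectColumns m).reverse ++ R)))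
        .bad (List.replicate ((p.filter fun q => !q.2).map fun q =>
          mismatches q.1.target q.1.source).sum none ++ S .bad))
      (p.length * (12 * N + 2) + 1) := by
  induction p generalizing S R with
  | nil =>
    refine (runs_loop_exit_nil hprev rfl).of_eq_of_le (funext fun k => ?_) (by simp)
    cases k <;> simp_all [encodeList_nil]
  | cons q p ih =>
    rw [List.map_cons, length_encodeList_cons] at hN
    rw [List.forall_mem_cons] at hm
    have hprev_ne : S .prev ≠ [] := by simp [hprev, encodeList_cons]
    obtain ⟨r, b | b⟩ := q
    · refine (runs_whileNonempty_cons hprev_ne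
        (runs_emitVertex_unmarked hprev hscan hrow hsrc htmp)
        (ih rfl hinp rfl hmask hrow hsrc htmp haux hm.2 (by omega))).of_eq_of_le
        (funext fun k => ?_) (by rw [List.length_cons]; lia)
      cases k <;> simp [← List.append_assoc, add_comm]
    · refine (runs_whileNonempty_cons hprev_ne
        (runs_emitVertex_marked hprev hinp hscan hmask hrow hsrc htmp haux hm.1)
        (ih rfl rfl rfl hmask hrow hsrc htmp haux hm.2 (by omega))).of_eq_of_le
        (funext fun k => ?_) (by rw [List.length_cons]; lia)
      cases k <;> simp

variable {p : List (VertexRecord × Bool)} {k : List Bool}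

theorem runs_emitMarked (hmarks : marks (p.map Prod.fst).reverse = (p.map Prod.snd).reverse)
    (hrow : ∀ q ∈ p, q.1.row.length = p.length) {N : ℕ}
    (hN : k.length + 1 + (encodeList (p.map Prod.fst)).length ≤ N) :
    Runs emitMarked
      (Function.update (fun _ => []) .inp (k.map some ++ none :: encodeList (p.map Prod.fst)))
      (Function.update (Function.update (Function.update (Function.update (fun _ => [])
        .inp (encodeList ((p.filter Prod.snd).map fun q => q.1.selectColumns (p.map Prod.snd))))
        .out (none :: (k.map some).reverse)) .mask ((p.map Prod.snd).map some).reverse)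
        .bad (List.replicate ((p.filter fun q => !q.2).map fun q =>
          mismatches q.1.target q.1.source).sum none))
      (20 * N ^ 3 + 42 * N ^ 2 + 13 * N + 6) := by
  have hp : p.length ≤ N := by
    have := length_le_length_encodeList (p.map Prod.fst)
    rw [List.length_map] at this
    omega
  refine .of_eq_of_le (.seq (runs_readWord (by simp) rfl) <| .seq (.push _ _ _) <|
    .seq (runs_addVertices (R := p.map Prod.fst) (L := []) (N := N) rfl rfl rfl rfl rfl rfl rfl
      rfl rfl rfl (by rw [encodeList_nil, List.length_nil]; omega)) <|
    .seq (runs_copy (by simp) rfl) <|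
    runs_emitVertices (p := p.reverse) (R := []) (m := p.map Prod.snd) (N := N) (by simp) rfl
      (by simp [hmarks]) (by simp [hmarks]) rfl rfl rfl rfl (by simpa using hrow) ?_)
    (funext fun k => ?_) ?_
  · rw [List.map_reverse, length_encodeList_reverse]
    omega
  · cases k <;> simp [hmarks]
  · have := Nat.mul_le_mul_right (N * (20 * N + 30) + 2) hp
    have := Nat.mul_le_mul_right (12 * N + 2) hp
    simp only [length_marks, List.length_map, List.length_reverse, List.append_nil, ne_eq,
      reduceCtorEq, not_false_eq_true, Function.update_of_ne, Function.update_idem,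
      Function.update_self]
    lia

theorem runs_kernelProg (hmarks : marks (p.map Prod.fst).reverse = (p.map Prod.snd).reverse)
    (hrow : ∀ q ∈ p, q.1.row.length = p.length) (w : List (Option Bool)) {N : ℕ}
    (hN : k.length + 1 + (encodeList (p.map Prod.fst)).length ≤ N) :
    Runs (kernelProg w)
      (Function.update (fun _ => []) .inp (k.map some ++ none :: encodeList (p.map Prod.fst)))
      (Function.update (fun _ => []) .inp
        (if ∀ q ∈ p, q.2 = false → q.1.target = q.1.source then
          k.map some ++ none :: encodeList
            ((p.filter Prod.snd).map fun q => q.1.selectColumns (p.map Prod.snd))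
        else w))
      (5 * (20 * N ^ 3 + 42 * N ^ 2 + 13 * N + 6) + 6 * N + 6 + w.length) := by
  have emit := runs_emitMarked hmarks hrow hN
  have hp : p.length ≤ N := by
    have := length_le_length_encodeList (p.map Prod.fst)
    rw [List.length_map] at this
    omega
  have length_inp := emit.length_le .inp
  have length_bad := emit.length_le .bad
  set d := ((p.filter fun q => !q.2).map fun q => mismatches q.1.target q.1.source).sum with hd
  have d_eq_zero : d = 0 ↔ ∀ q ∈ p, q.2 = false → q.1.target = q.1.source := by
    simp [hd, List.sum_eq_zero_iff_forall_eq_nat, mismatches_eq_zero]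
  rcases hd0 : d with _ | d'
  · rw [if_pos (d_eq_zero.1 hd0)]
    refine .of_eq_of_le (.seq emit (runs_popCase_nil (by simp [hd0])
      (.seq (runs_clear _) (runs_move (by simp))))) (funext fun k => ?_) ?_
    · cases k <;> simp [hd0]
    · simp only [ne_eq, reduceCtorEq, not_false_eq_true, Function.update_of_ne,
        Function.update_self, List.length_reverse, List.length_map, List.length_cons]
      lia
  · rw [if_neg (d_eq_zero.not.1 (by omega))]
    refine .of_eq_of_le (.seq emit (runs_popCase_cons (l := List.replicate d' none)
      (by rw [Function.update_self, hd0]; rfl) (.seq (runs_clear _) <| .seq (runs_clear _) <|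
        .seq (runs_clear _) <| .seq (runs_clear _) (runs_pushAll _ w)))) (funext fun k => ?_) ?_
    · cases k <;> simp
    · simp only [ne_eq, reduceCtorEq, not_false_eq_true, Function.update_of_ne,
        Function.update_idem, Function.update_self, List.length_append, List.length_map,
        List.length_cons, List.length_nil, List.length_replicate, List.length_reverse]
        at length_inp length_bad ⊢
      lia

end KernelProg

theorem length_encodeNat_le (n : ℕ) : (encodeNat n).length ≤ n := by
  have length_encodePosNum_le (m : PosNum) : (encodePosNum m).length ≤ (m : ℕ) := by
    induction m with
    | one => simp [encodePosNum]
    | bit0 m ih =>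
      have := m.cast_pos (α := ℕ)
      simp only [encodePosNum, List.length_cons, PosNum.cast_bit0]
      lia
    | bit1 m ih =>
      simp only [encodePosNum, List.length_cons, PosNum.cast_bit1]
      lia
  suffices ∀ m : Num, (encodeNum m).length ≤ (m : ℕ) by simpa [encodeNat] using this n
  rintro (_ | m)
  · exact le_rfl
  · exact length_encodePosNum_le m

namespace SplitCRCSInstance

open VertexRecord

variable (x : SplitCRCSInstance)

open Classical in
/-- The data of a vertex in the encoding of an instance. -/
noncomputable def record (v : Fin x.numVertices) : VertexRecord where
  row := List.ofFn fun w => decide (x.toInstance.graph.Adj v w)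
  source := encodeNat (x.toInstance.source v)
  target := encodeNat (x.toInstance.target v)

theorem encode_eq_encodeList : x.encode = (encodeNat x.toInstance.numColors).map some ++
    none :: encodeList ((List.finRange x.numVertices).map x.record) := by
  have flatten_eq : (List.ofFn x.vertexWords).flatten =
      ((List.finRange x.numVertices).map x.record).flatMap words := by
    rw [List.ofFn_eq_map, List.flatMap_map, List.flatMap_def]
    rfl
  simp [encode, flatten_eq, joinWords, encodeList]

theorem size_record_le (v : Fin x.numVertices) :
    (x.record v).size ≤ x.numVertices + 2 * x.toInstance.numColors + 3 := by
  have source_le := length_encodeNat_le (x.toInstance.source v)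
  have target_le := length_encodeNat_le (x.toInstance.target v)
  simp only [size, record, List.length_ofFn]
  lia

theorem length_encode_le : x.encode.length ≤ x.toInstance.numColors + 1 +
    x.numVertices * (x.numVertices + 2 * x.toInstance.numColors + 3) := by
  have numColors_le := length_encodeNat_le x.toInstance.numColors
  have records_le := length_encodeList_le (L := (List.finRange x.numVertices).map x.record)
    (List.forall_mem_map.2 fun v _ => x.size_record_le v)
  rw [encode_eq_encodeList]
  simp only [List.length_append, List.length_map, List.length_cons, List.length_finRange]
    at records_le ⊢
  lia

theorem twin_record_iff (v w : Fin x.numVertices) :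
    (x.record v).twin (x.record w) = true ↔ ColoredTwins x.toInstance.source w v := by
  rw [twin, decide_eq_true_eq]
  simp only [record, List.ofFn_inj, funext_iff, decide_eq_decide]
  exact and_congr Set.ext_iff.symm
    ⟨fun h => Fin.ext (encodeNat_inj h), fun h => congrArg (encodeNat ·.val) h⟩

theorem target_record_eq_iff (v : Fin x.numVertices) :
    (x.record v).target = (x.record v).source ↔ x.toInstance.source v = x.toInstance.target v :=
  ⟨fun h => Fin.ext (encodeNat_inj h.symm), fun h => by simp only [record, h]⟩

open Classical in
/-- Whether the kernel keeps a vertex. -/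
noncomputable def mark (v : Fin x.numVertices) : Bool :=
  decide (¬ IsRedundant x.toInstance.source v)

theorem marks_record : marks ((List.finRange x.numVertices).map x.record).reverse =
    ((List.finRange x.numVertices).map x.mark).reverse := by
  rw [← List.map_reverse, ← List.map_reverse,
    marks_map x.record (List.pairwise_reverse.2 (List.pairwise_lt_finRange _)) (by simp)]
  refine List.map_congr_left fun v _ => decide_eq_decide.2 (not_congr ?_)
  rw [IsRedundant]
  simp only [twin_record_iff]

/-- The vertices of the kernel. -/
noncomputable def kept : List (Fin x.numVertices) := (List.finRange x.numVertices).filter x.mark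

theorem nodup_kept : x.kept.Nodup := (List.nodup_finRange _).filter _

theorem mem_kept {v : Fin x.numVertices} : v ∈ x.kept ↔ ¬ IsRedundant x.toInstance.source v := by
  simp [kept, mark]

/-- The vertices of the kernel, renumbered in their order. -/
noncomputable def keptEmbedding : Fin x.kept.length ↪ Fin x.numVertices :=
  ⟨x.kept.get, x.nodup_kept.injective_get⟩

theorem mem_range_keptEmbedding {v : Fin x.numVertices} :
    v ∈ Set.range x.keptEmbedding ↔ ¬ IsRedundant x.toInstance.source v :=
  List.mem_iff_get.symm.trans x.mem_kept

theorem twinsKept_keptEmbedding : TwinsKept x.toInstance.source x.keptEmbedding := by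
  intro w hw
  obtain ⟨a, b, hab, ha, hb, twins⟩ :=
    (not_not.1 (x.mem_range_keptEmbedding.not.1 hw)).exists_not_isRedundant
  obtain ⟨a, rfl⟩ := x.mem_range_keptEmbedding.2 ha
  obtain ⟨b, rfl⟩ := x.mem_range_keptEmbedding.2 hb
  exact ⟨a, b, ne_of_apply_ne _ hab, twins⟩

theorem length_kept_le : x.kept.length ≤
    x.toInstance.numColors + 2 * x.toInstance.numColors * 2 ^ x.toInstance.numColors := by
  obtain ⟨C, I, h⟩ := x.isSplit
  rw [← List.toFinset_card_of_nodup x.nodup_kept, mul_assoc]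
  refine (h.card_le_of_coloredTwins x.toInstance.source _ fun t ht twins => ?_).trans_eq
    (by rw [Fintype.card_fin])
  exact card_le_two_of_not_isRedundant
    (fun v hv => x.mem_kept.1 (List.mem_toFinset.1 (ht hv))) twins

/-- The instance induced on the vertices of the kernel. -/
noncomputable def reduced : SplitCRCSInstance where
  numVertices := x.kept.length
  toInstance := x.toInstance.restrict x.keptEmbedding
  isSplit :=
    let ⟨_, _, h⟩ := x.isSplit
    ⟨_, _, h.comap x.keptEmbedding⟩

open Classical in
theorem map_record_reduced : (List.finRange x.reduced.numVertices).map x.reduced.record =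
    x.kept.map fun v => (x.record v).selectColumns ((List.finRange x.numVertices).map x.mark) := by
  have kept_eq : (List.finRange x.kept.length).map x.keptEmbedding = x.kept :=
    x.kept.map_get_finRange
  rw [← kept_eq, List.map_map]
  refine List.map_congr_left fun i _ => ?_
  simp only [Function.comp, record, selectColumns, VertexRecord.mk.injEq, List.ofFn_eq_map,
    List.zip_map', List.filter_map]
  refine ⟨?_, rfl, rfl⟩
  rw [List.map_map]
  exact List.map_map.symm.trans
    (congrArg (List.map fun w => decide (x.toInstance.graph.Adj (x.keptEmbedding i) w)) kept_eq)

/-- Two isolated vertices exchanging their colors. -/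
def negative : SplitCRCSInstance where
  numVertices := 2
  toInstance :=
    { graph := ⊥
      numColors := 2
      numColors_pos := two_pos
      source := SimpleGraph.Coloring.mk id fun h => h.elim
      target := SimpleGraph.Coloring.mk Fin.rev fun h => h.elim }
  isSplit := ⟨∅, Set.univ, by simp, fun _ _ _ _ _ h => h, by simp, by simp⟩

theorem not_isYes_negative : ¬ negative.toInstance.IsYes := by
  intro h
  rcases Relation.ReflTransGen.cases_head h with h | ⟨_, ⟨_, _, hadj, _⟩, _⟩
  · exact absurd (DFunLike.congr_fun h (0 : Fin 2)) (by decide)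
  · exact hadj

theorem isValid_negative : negative.toInstance.IsValid := by
  intro c
  change Fin 2 at c
  have rev_eq : {v : Fin 2 | v.rev = c} = {c.rev} := Set.ext fun v => Fin.rev_eq_iff
  exact (Set.ncard_singleton c).trans (rev_eq ▸ Set.ncard_singleton c.rev).symm

open Classical in
/-- The kernelization of CRCS on split graphs: the redundant vertices are deleted, unless one of
them changes its color, in which case the answer is negative. -/
noncomputable def kernel : SplitCRCSInstance :=
  if ∀ v, IsRedundant x.toInstance.source v → x.toInstance.source v = x.toInstance.target v
  then x.reduced else negative

open Classical in
theorem encode_kernel : x.kernel.encode =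
    if ∀ v, IsRedundant x.toInstance.source v → x.toInstance.source v = x.toInstance.target v
    then (encodeNat x.toInstance.numColors).map some ++ none :: encodeList (x.kept.map fun v =>
      (x.record v).selectColumns ((List.finRange x.numVertices).map x.mark))
    else negative.encode := by
  rw [← map_record_reduced, kernel, apply_ite encode, encode_eq_encodeList x.reduced]
  rfl

theorem kernel_cases (P : SplitCRCSInstance → Prop)
    (reduced : (∀ v ∉ Set.range x.keptEmbedding, x.toInstance.source v = x.toInstance.target v) →
      P x.reduced)
    (negative : ¬ x.toInstance.IsYes → P negative) : P x.kernel := by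
  by_cases fixed :
      ∀ v, IsRedundant x.toInstance.source v → x.toInstance.source v = x.toInstance.target v
  · rw [kernel, if_pos fixed]
    exact reduced fun v hv => fixed v (not_not.1 (x.mem_range_keptEmbedding.not.1 hv))
  · rw [kernel, if_neg fixed]
    push Not at fixed
    obtain ⟨v, ⟨a, ha, -⟩, moved⟩ := fixed
    exact negative (CRCSInstance.not_isYes_of_coloredTwins ha.1.ne' ha.2.symm moved)

theorem isYes_kernel_iff : x.kernel.toInstance.IsYes ↔ x.toInstance.IsYes :=
  x.kernel_cases (fun y => y.toInstance.IsYes ↔ x.toInstance.IsYes)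
    (CRCSInstance.isYes_restrict_iff x.twinsKept_keptEmbedding) (iff_of_false not_isYes_negative)

variable {x} in
theorem isValid_kernel (hx : x.toInstance.IsValid) : x.kernel.toInstance.IsValid :=
  x.kernel_cases (fun y => y.toInstance.IsValid) (CRCSInstance.IsValid.restrict hx)
    fun _ => isValid_negative

theorem numVertices_kernel_le : x.kernel.numVertices ≤
    x.toInstance.numColors + 2 * x.toInstance.numColors * 2 ^ x.toInstance.numColors := by
  refine x.kernel_cases (fun y => y.numVertices ≤ _) (fun _ => x.length_kept_le) fun _ => ?_
  calc 2 ≤ 2 * x.toInstance.numColors := Nat.le_mul_of_pos_right 2 x.toInstance.numColors_pos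
    _ ≤ 2 * x.toInstance.numColors * 2 ^ x.toInstance.numColors :=
      Nat.le_mul_of_pos_right _ (Nat.two_pow_pos _)
    _ ≤ _ := Nat.le_add_left _ _

theorem numColors_kernel_le : x.kernel.toInstance.numColors ≤ x.toInstance.numColors + 2 :=
  x.kernel_cases (fun y => y.toInstance.numColors ≤ _) (fun _ => Nat.le_add_right _ _)
    fun _ => Nat.le_add_left _ _

theorem polyTime_kernel : Nonempty (Turing.TM2ComputableInPolyTime encode encode kernel) := by
  classical
  open Polynomial in
  refine (KernelProg.kernelProg negative.encode).nonempty_tm2ComputableInPolyTime Stk.inp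
    (5 * (20 * X ^ 3 + 42 * X ^ 2 + 13 * X + 6) + 6 * X + 6 + C negative.encode.length)
    fun x => ?_
  let p := (List.finRange x.numVertices).map fun v => (x.record v, x.mark v)
  have fst : p.map Prod.fst = (List.finRange x.numVertices).map x.record := List.map_map
  have snd : p.map Prod.snd = (List.finRange x.numVertices).map x.mark := List.map_map
  have row : ∀ q ∈ p, q.1.row.length = p.length := by simp [p, record]
  have runs := KernelProg.runs_kernelProg (fst ▸ snd ▸ x.marks_record) row negative.encode
    (k := encodeNat x.toInstance.numColors) (N := x.encode.length) (by
      rw [fst, encode_eq_encodeList, List.length_append, List.length_map, List.length_cons]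
      lia)
  rw [fst, snd, ← encode_eq_encodeList] at runs
  have kept_eq : (p.filter Prod.snd).map
      (fun q => q.1.selectColumns ((List.finRange x.numVertices).map x.mark)) = x.kept.map fun v =>
      (x.record v).selectColumns ((List.finRange x.numVertices).map x.mark) := by
    rw [List.filter_map, List.map_map]
    rfl
  have fixed_iff : (∀ q ∈ p, q.2 = false → q.1.target = q.1.source) ↔
      ∀ v, IsRedundant x.toInstance.source v → x.toInstance.source v = x.toInstance.target v := by
    simp [p, mark, target_record_eq_iff]
  convert runs using 1
  · rw [encode_kernel, kept_eq, if_congr fixed_iff rfl rfl]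
  · simp

end SplitCRCSInstance

/-- A bound for the size of the kernel of an instance with `k` colors: at most `k + 2` colors, and
`k + 2 * k * 2 ^ k` vertices. -/
def kernelSizeBound (k : ℕ) : ℕ :=
  let n := k + 2 * k * 2 ^ k
  k + 2 + 1 + n * (n + 2 * (k + 2) + 3) + (k + 2)

theorem computable_kernelSizeBound : Computable kernelSizeBound := by
  have pow : Primrec₂ fun a b : ℕ => a ^ b := Primrec₂.unpaired'.1 Nat.Primrec.pow
  have add {f g : ℕ → ℕ} (hf : Primrec f) (hg : Primrec g) : Primrec fun k => f k + g k :=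
    Primrec.nat_add.comp hf hg
  have mul {f g : ℕ → ℕ} (hf : Primrec f) (hg : Primrec g) : Primrec fun k => f k * g k :=
    Primrec.nat_mul.comp hf hg
  have const (c : ℕ) : Primrec fun _ : ℕ => c := Primrec.const c
  have id : Primrec fun k : ℕ => k := Primrec.id
  have vertices : Primrec fun k : ℕ => k + 2 * k * 2 ^ k :=
    add id (mul (mul (const 2) id) (pow.comp (const 2) id))
  have colors : Primrec fun k : ℕ => k + 2 := add id (const 2)
  exact (add (add (add colors (const 1)) (mul vertices
    (add (add vertices (mul (const 2) colors)) (const 3)))) colors).to_comp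

theorem isKernelization_kernel : splitCRCS.IsKernelization SplitCRCSInstance.kernel where
  polyTime := SplitCRCSInstance.polyTime_kernel
  equivalent := SplitCRCSInstance.isYes_kernel_iff
  size_le := by
    refine ⟨kernelSizeBound, computable_kernelSizeBound, fun x => ?_⟩
    have colors_le := x.numColors_kernel_le
    have vertices_le := x.numVertices_kernel_le
    refine Nat.add_le_add (x.kernel.length_encode_le.trans ?_) colors_le
    exact Nat.add_le_add (Nat.succ_le_succ colors_le) (Nat.mul_le_mul vertices_le
      (Nat.add_le_add_right (Nat.add_le_add vertices_le (Nat.mul_le_mul_left 2 colors_le)) 3))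

theorem mainTheorem8_general :
    (∀ (V : Type u) (x : CRCSInstance V) (I : Set V) (a b : V),
      x.Rule1Applies I a b → ¬ x.IsYes) ∧
    (∀ (V : Type u) (x : CRCSInstance V) (I : Set V), (∀ a b : V, ¬ x.Rule1Applies I a b) →
      ∀ a b w : V, x.Rule2Applies I a b w →
        (∀ C : Set V, IsSplitPartition x.graph C I →
          IsSplitPartition (x.deleteVertex w).graph (Subtype.val ⁻¹' C) (Subtype.val ⁻¹' I)) ∧
        (Finite V → x.IsValid → (x.deleteVertex w).IsValid) ∧
        ((x.deleteVertex w).IsYes ↔ x.IsYes)) ∧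
    (∃ K : SplitCRCSInstance → SplitCRCSInstance,
      splitCRCS.IsKernelization K ∧
      (∀ x, x.toInstance.IsValid → (K x).toInstance.IsValid) ∧
      ∀ x, (K x).numVertices ≤
        x.toInstance.numColors + 2 * x.toInstance.numColors * 2 ^ x.toInstance.numColors) := by
  refine ⟨fun V x I a b h => h.not_isYes, fun V x I rule1 a b w h => ?_, SplitCRCSInstance.kernel,
    isKernelization_kernel, fun _ => SplitCRCSInstance.isValid_kernel,
    SplitCRCSInstance.numVertices_kernel_le⟩
  have fixed := h.fixed rule1
  rw [CRCSInstance.deleteVertex_eq_restrict]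
  exact ⟨fun C split => split.comap _, fun _ valid => valid.restrict fixed,
    CRCSInstance.isYes_restrict_iff h.twinsKept fixed⟩

theorem mainTheorem8 :
    -- the first reduction rule is safe
    (∀ (V : Type u) [Finite V] (x : CRCSInstance V) (C I : Set V),
      IsSplitPartition x.graph C I → ∀ a b : V, x.Rule1Applies I a b → ¬ x.IsYes) ∧
    -- the second reduction rule is safe, once the first one cannot be applied
    (∀ (V : Type u) [Finite V] (x : CRCSInstance V) (C I : Set V),
      IsSplitPartition x.graph C I → (∀ a b : V, ¬ x.Rule1Applies I a b) →
      ∀ a b w : V, x.Rule2Applies I a b w →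
        IsSplitPartition (x.deleteVertex w).graph (Subtype.val ⁻¹' C) (Subtype.val ⁻¹' I) ∧
        (x.IsValid → (x.deleteVertex w).IsValid) ∧
        ((x.deleteVertex w).IsYes ↔ x.IsYes)) ∧
    -- there is a kernel with at most `k + 2k * 2^k` vertices
    (∃ K : SplitCRCSInstance → SplitCRCSInstance,
      splitCRCS.IsKernelization K ∧
      (∀ x, x.toInstance.IsValid → (K x).toInstance.IsValid) ∧
      ∀ x, (K x).numVertices ≤
        x.toInstance.numColors + 2 * x.toInstance.numColors * 2 ^ x.toInstance.numColors) := by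
  obtain ⟨rule1, rule2, kernel⟩ := mainTheorem8_general.{u}
  exact ⟨fun V _ x _ I _ => rule1 V x I, fun V _ x C I split not_rule1 a b w h =>
    (rule2 V x I not_rule1 a b w h).imp (· C split) (And.imp_left (· ‹_›)), kernel⟩
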